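/- **Proposition (parallel complex structures on $TM$).** Let $M$ be a smooth manifold with an almost Norden structure: a smooth pseudo-Riemannian metric $g$ and a smooth almost complex structure $J$ (so $J^2=-\mathrm{Id}$) with $g(JX,JY)=-g(X,Y)$; then $g$ and the associated metric $\widetilde g=g(\cdot,J\cdot)$ have neutral signature. Let $\nabla$ be the Levi-Civita connection of $g$ and $R$ its curvature tensor. Call the base *flat* if $R=0$, and say that *$J$ is parallel* if $\nabla J=0$. For $u\in T_pM\subset TM$ and $X\in T_pM$ let $X^H,X^V\in T_u(TM)$ be the horizontal (with respect to $\nabla$) and the vertical lift of $X$. Define endomorphism fields $J_1,J_2,J_3$ and a metric $\widehat g$ (the complete lift of $g$) on $TM$ by $$J_1X^H=-(JX)^H,\quad J_1X^V=(JX)^V;\qquad J_2X^H=X^V,\quad J_2X^V=-X^H;\qquad J_3X^H=(JX)^V,\quad J_3X^V=(JX)^H;$$ $$\widehat g(X^H,Y^H)=\widehat g(X^V,Y^V)=0,\qquad \widehat g(X^H,Y^V)=\widehat g(X^V,Y^H)=g(X,Y).$$ Let $\widehat\nabla$ be the Levi-Civita connection of $\widehat g$, and put $H=(J_1,J_2,J_3)$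 and $\widehat G=(\widehat g,\widehat g(J_1\cdot,\cdot),\widehat g(J_2\cdot,\cdot),\widehat g(J_3\cdot,\cdot))$. A *complex structure* is an almost complex structure with vanishing Nijenhuis tensor. Then: 1. For $\alpha=1$ and for $\alpha=3$: $\widehat\nabla J_\alpha=0$ if and only if the base is flat and $J$ is parallel. Equivalently, $J_\alpha$ is a complex structure with $\widehat\nabla J_\alpha=0$ if and only if the base is flat and $J$ is parallel. 2. $\widehat\nabla J_2=0$ if and only if the base is flat. Equivalently, $J_2$ is a complex structure with $\widehat\nabla J_2=0$ if and only if the base is flat. 3. $(TM,H,\widehat G)$ is a pseudo-hyper-Kähler manifold if and only if the base is flat and $J$ is parallel. Here $(TM,H,\widehat G)$ is *pseudo-hyper-Kähler* if $J_1,J_2,J_3$ are pairwise anticommuting almost complex structures with $J_3=J_1J_2$, $\widehat g$ is a pseudo-Riemannian metric with $\widehat g(\cdot,\cdot)=\widehat g(J_1\cdot,J_1\cdot)=-\widehat g(J_2\cdot,J_2\cdot)=-\widehat g(J_3\cdot,J_3\cdot)$, and the tensors $F_\alpha(x,y,z)=\widehat g\big((\widehat\nabla_xJ_\alpha)y,z\big)$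 vanish for $\alpha=1,2,3$. -/

import Mathlib

open Bundle
open scoped Manifold ContDiff

noncomputable section

namespace NordenTangent

/-! ### Tensor fields and connections on a smooth manifold `N` -/

section General

variable {E : Type*} [NormedAddCommGroup E] [NormedSpace ℝ E]
  {H : Type*} [TopologicalSpace H] (I : ModelWithCorners ℝ E H)
  {N : Type*} [TopologicalSpace N] [ChartedSpace H N]

/-- A field of endomorphisms of the tangent spaces of `N`. -/
abbrev EndField (N : Type*) [TopologicalSpace N] [ChartedSpace H N] :=
  ∀ x : N, TangentSpace I x →L[ℝ] TangentSpace I x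

/-- A field of bilinear forms on the tangent spaces of `N`. -/
abbrev FormField (N : Type*) [TopologicalSpace N] [ChartedSpace H N] :=
  ∀ x : N, TangentSpace I x →L[ℝ] TangentSpace I x →L[ℝ] ℝ

/-- The underlying map of a connection on `TN`: `cov Y x v` is `(∇_v Y)(x)`. -/
abbrev Connection (N : Type*) [TopologicalSpace N] [ChartedSpace H N] :=
  (∀ x : N, TangentSpace I x) → ∀ x : N, TangentSpace I x →L[ℝ] TangentSpace I x

variable {I}

/-- `J` is an almost complex structure: a smooth `(1,1)`-tensor field with `J² = -1`. -/
structure IsAlmostComplex [IsManifold I ∞ N] (J : EndField I N) : Prop where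
  smooth : ContMDiff I (I.prod 𝓘(ℝ, E →L[ℝ] E)) ∞
    (fun x ↦ TotalSpace.mk' (E →L[ℝ] E)
      (E := fun x : N ↦ TangentSpace I x →L[ℝ] TangentSpace I x) x (J x))
  sq : ∀ (x : N) (v : TangentSpace I x), J x (J x v) = -v

/-- `g` is a pseudo-Riemannian metric: a smooth field of nondegenerate symmetric bilinear forms. -/
structure IsPseudoRiemannian [IsManifold I ∞ N] (g : FormField I N) : Prop where
  smooth : ContMDiff I (I.prod 𝓘(ℝ, E →L[ℝ] E →L[ℝ] ℝ)) ∞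
    (fun x ↦ TotalSpace.mk' (E →L[ℝ] E →L[ℝ] ℝ)
      (E := fun x : N ↦ TangentSpace I x →L[ℝ] TangentSpace I x →L[ℝ] ℝ) x (g x))
  symm : ∀ (x : N) (v w : TangentSpace I x), g x v w = g x w v
  nondegenerate : ∀ (x : N) (v : TangentSpace I x), (∀ w, g x v w = 0) → v = 0

/-- An almost Norden structure: an almost complex structure `J` acting as an anti-isometry of the
pseudo-Riemannian metric `g`. That `g` has neutral signature is a consequence, since `J` exchanges
`g` and `-g`. The associated metric is `g(·, J ·)`. -/
structure IsAlmostNorden [IsManifold I ∞ N] (J : EndField I N) (g : FormField I N) : Prop where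
  almostComplex : IsAlmostComplex J
  metric : IsPseudoRiemannian g
  anti_isometry : ∀ (x : N) (v w : TangentSpace I x), g x (J x v) (J x w) = -g x v w

/-- The covariant derivative `cov` is torsion-free and compatible with `g`. -/
structure IsLeviCivita [FiniteDimensional ℝ E] [IsManifold I ∞ N]
    (g : FormField I N) (cov : CovariantDerivative I E (TangentSpace I : N → Type _)) : Prop where
  torsion_free :
    haveI : CompleteSpace E := FiniteDimensional.complete ℝ E
    cov.torsion = 0
  metric : ∀ (x : N) (Y Z : ∀ x : N, TangentSpace I x),
    MDifferentiableAt I (I.prod 𝓘(ℝ, E)) (fun y ↦ TotalSpace.mk' E y (Y y)) x →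
    MDifferentiableAt I (I.prod 𝓘(ℝ, E)) (fun y ↦ TotalSpace.mk' E y (Z y)) x →
    ∀ v : TangentSpace I x,
      mvfderiv I (fun y ↦ g y (Y y) (Z y)) x v =
        g x (cov Y x v) (Z x) + g x (Y x) (cov Z x v)

open Classical in
/-- The Levi-Civita connection of `g`. It exists whenever `g` is a pseudo-Riemannian metric, and
its values on differentiable vector fields are then unique; the values on other fields, and the
value `0` given here when there is none, carry no information. -/
def leviCivita [FiniteDimensional ℝ E] [IsManifold I ∞ N]
    (g : FormField I N) : Connection I N :=
  if h : ∃ cov : CovariantDerivative I E (TangentSpace I : N → Type _), IsLeviCivita g cov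
  then h.choose.toFun else 0

/-- The curvature `R(X,Y)Z = ∇_X ∇_Y Z - ∇_Y ∇_X Z - ∇_{[X,Y]} Z`. -/
def curvature (cov : Connection I N) (X Y Z : ∀ x : N, TangentSpace I x) :
    ∀ x : N, TangentSpace I x :=
  fun x ↦ cov (fun y ↦ cov Z y (Y y)) x (X x) - cov (fun y ↦ cov Z y (X y)) x (Y x)
    - cov Z x (VectorField.mlieBracket I X Y x)

/-- The curvature tensor vanishes: `R(X,Y)Z = 0` at `x` for all `X`, `Y`, `Z` smooth near `x`. -/
def IsFlat [IsManifold I ∞ N] (cov : Connection I N) : Prop :=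
  ∀ (x : N) (X Y Z : ∀ x : N, TangentSpace I x),
    ContMDiffAt I (I.prod 𝓘(ℝ, E)) ∞ (fun y ↦ TotalSpace.mk' E y (X y)) x →
    ContMDiffAt I (I.prod 𝓘(ℝ, E)) ∞ (fun y ↦ TotalSpace.mk' E y (Y y)) x →
    ContMDiffAt I (I.prod 𝓘(ℝ, E)) ∞ (fun y ↦ TotalSpace.mk' E y (Z y)) x →
    curvature cov X Y Z x = 0

/-- `((∇_v J) Y)(x) = (∇_v (J Y))(x) - J (∇_v Y)(x)`. -/
def derivEnd (cov : Connection I N) (J : EndField I N) (x : N) (v : TangentSpace I x)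
    (Y : ∀ x : N, TangentSpace I x) : TangentSpace I x :=
  cov (fun y ↦ J y (Y y)) x v - J x (cov Y x v)

/-- `∇ J = 0`. -/
def IsParallel [IsManifold I ∞ N] (cov : Connection I N) (J : EndField I N) : Prop :=
  ∀ (x : N) (v : TangentSpace I x) (Y : ∀ x : N, TangentSpace I x),
    MDifferentiableAt I (I.prod 𝓘(ℝ, E)) (fun y ↦ TotalSpace.mk' E y (Y y)) x →
    derivEnd cov J x v Y = 0

/-- The Nijenhuis tensor `[X,Y] + J[JX,Y] + J[X,JY] - [JX,JY]`. -/
def nijenhuis (J : EndField I N) (X Y : ∀ x : N, TangentSpace I x) :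
    ∀ x : N, TangentSpace I x :=
  fun x ↦ VectorField.mlieBracket I X Y x
    + J x (VectorField.mlieBracket I (fun y ↦ J y (X y)) Y x)
    + J x (VectorField.mlieBracket I X (fun y ↦ J y (Y y)) x)
    - VectorField.mlieBracket I (fun y ↦ J y (X y)) (fun y ↦ J y (Y y)) x

/-- `J` is a complex structure: an almost complex structure with vanishing Nijenhuis tensor. -/
structure IsComplex [IsManifold I ∞ N] (J : EndField I N) : Prop where
  almostComplex : IsAlmostComplex J
  integrable : ∀ (x : N) (X Y : ∀ x : N, TangentSpace I x),
    MDifferentiableAt I (I.prod 𝓘(ℝ, E)) (fun y ↦ TotalSpace.mk' E y (X y)) x →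
    MDifferentiableAt I (I.prod 𝓘(ℝ, E)) (fun y ↦ TotalSpace.mk' E y (Y y)) x →
    nijenhuis J X Y x = 0

/-- An almost hypercomplex structure `(J₁, J₂, J₃)`: anticommuting almost complex structures with
`J₃ = J₁ ∘ J₂`. -/
structure IsAlmostHypercomplex [IsManifold I ∞ N] (J₁ J₂ J₃ : EndField I N) : Prop where
  almostComplex₁ : IsAlmostComplex J₁
  almostComplex₂ : IsAlmostComplex J₂
  almostComplex₃ : IsAlmostComplex J₃
  comp_eq : ∀ (x : N) (v : TangentSpace I x), J₃ x v = J₁ x (J₂ x v)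
  anticomm₁₂ : ∀ (x : N) (v : TangentSpace I x), J₁ x (J₂ x v) = -J₂ x (J₁ x v)
  anticomm₂₃ : ∀ (x : N) (v : TangentSpace I x), J₂ x (J₃ x v) = -J₃ x (J₂ x v)
  anticomm₃₁ : ∀ (x : N) (v : TangentSpace I x), J₃ x (J₁ x v) = -J₁ x (J₃ x v)

/-- An almost hypercomplex Hermitian-Norden structure:
`g = g(J₁·, J₁·) = -g(J₂·, J₂·) = -g(J₃·, J₃·)`. Neutral signature of `g` is a consequence, since
`J₂` exchanges `g` and `-g`. The further forms `g(J₁·, ·)`, `g(J₂·, ·)`, `g(J₃·, ·)` of the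
structure are determined by these data. -/
structure IsAlmostHypercomplexHermitianNorden [IsManifold I ∞ N] (J₁ J₂ J₃ : EndField I N)
    (g : FormField I N) : Prop where
  hypercomplex : IsAlmostHypercomplex J₁ J₂ J₃
  metric : IsPseudoRiemannian g
  hermitian₁ : ∀ (x : N) (v w : TangentSpace I x), g x (J₁ x v) (J₁ x w) = g x v w
  norden₂ : ∀ (x : N) (v w : TangentSpace I x), g x (J₂ x v) (J₂ x w) = -g x v w
  norden₃ : ∀ (x : N) (v w : TangentSpace I x), g x (J₃ x v) (J₃ x w) = -g x v w

/-- The structure tensor `F(v, Y, w) = g((∇_v J) Y, w)` vanishes, `∇` being the Levi-Civita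
connection of `g`. -/
def StructureTensorVanishes [FiniteDimensional ℝ E] [IsManifold I ∞ N]
    (g : FormField I N) (J : EndField I N) : Prop :=
  ∀ (x : N) (v w : TangentSpace I x) (Y : ∀ x : N, TangentSpace I x),
    MDifferentiableAt I (I.prod 𝓘(ℝ, E)) (fun y ↦ TotalSpace.mk' E y (Y y)) x →
    g x (derivEnd (leviCivita g) J x v Y) w = 0

/-- A pseudo-hyper-Kähler manifold: an almost hypercomplex Hermitian-Norden manifold all three of
whose structure tensors vanish. -/
structure IsPseudoHyperKahler [FiniteDimensional ℝ E] [IsManifold I ∞ N]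
    (J₁ J₂ J₃ : EndField I N) (g : FormField I N) : Prop where
  hermitianNorden : IsAlmostHypercomplexHermitianNorden J₁ J₂ J₃ g
  vanishes₁ : StructureTensorVanishes g J₁
  vanishes₂ : StructureTensorVanishes g J₂
  vanishes₃ : StructureTensorVanishes g J₃

end General

/-! ### Lifts to the tangent bundle -/

section Lifts

variable {E : Type*} [NormedAddCommGroup E] [NormedSpace ℝ E]
  {M : Type*} [TopologicalSpace M] [ChartedSpace E M] [IsManifold 𝓘(ℝ, E) ∞ M]

/-- The vertical lift `X ↦ X^V` from `T_p M` to `T_u(TM)`, where `u ∈ T_p M`: the derivative at `u`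
of the inclusion of the fibre `T_p M` into `TM`. -/
def verticalLift (u : TangentBundle 𝓘(ℝ, E) M) :
    TangentSpace 𝓘(ℝ, E) u.proj →L[ℝ] TangentSpace 𝓘(ℝ, E).tangent u :=
  let incl : E → TangentBundle 𝓘(ℝ, E) M := fun w ↦ TotalSpace.mk' E u.proj w
  mfderiv 𝓘(ℝ, E) 𝓘(ℝ, E).tangent incl (show E from u.snd)

/-- The horizontal lift `X ↦ X^H` from `T_p M` to `T_u(TM)`, where `u ∈ T_p M`:
`X^H = dσ_p(X) - (∇_X σ)^V` for a vector field `σ`, smooth near `p`, with `σ(p) = u`. -/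
def horizontalLift (cov : Connection 𝓘(ℝ, E) M) (u : TangentBundle 𝓘(ℝ, E) M) :
    TangentSpace 𝓘(ℝ, E) u.proj →L[ℝ] TangentSpace 𝓘(ℝ, E).tangent u :=
  let σ : ∀ x : M, TangentSpace 𝓘(ℝ, E) x := FiberBundle.extend E u.snd
  let dσ : TangentSpace 𝓘(ℝ, E) u.proj →L[ℝ] TangentSpace 𝓘(ℝ, E).tangent u :=
    mfderiv 𝓘(ℝ, E) 𝓘(ℝ, E).tangent
      (fun x ↦ (TotalSpace.mk' E x (σ x) : TangentBundle 𝓘(ℝ, E) M)) u.proj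
  dσ - (verticalLift u).comp (cov σ u.proj)

/-- The decomposition of `T_u(TM)` into horizontal and vertical parts, as the linear isomorphism
`(a, b) ↦ a^H + b^V` from `T_p M × T_p M`. -/
def liftSum (cov : Connection 𝓘(ℝ, E) M) (u : TangentBundle 𝓘(ℝ, E) M) :
    (TangentSpace 𝓘(ℝ, E) u.proj × TangentSpace 𝓘(ℝ, E) u.proj) →L[ℝ]
      TangentSpace 𝓘(ℝ, E).tangent u :=
  (horizontalLift cov u).coprod (verticalLift u)

/-- The horizontal and vertical parts `(a, b)` of a tangent vector `a^H + b^V` of `TM`. -/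
def parts (cov : Connection 𝓘(ℝ, E) M) (u : TangentBundle 𝓘(ℝ, E) M) :
    TangentSpace 𝓘(ℝ, E).tangent u →L[ℝ]
      (TangentSpace 𝓘(ℝ, E) u.proj × TangentSpace 𝓘(ℝ, E) u.proj) :=
  (liftSum cov u).inverse

/-- `J₁ : X^H ↦ -(J X)^H, X^V ↦ (J X)^V`. -/
def liftJ₁ (cov : Connection 𝓘(ℝ, E) M) (J : EndField 𝓘(ℝ, E) M) :
    EndField 𝓘(ℝ, E).tangent (TangentBundle 𝓘(ℝ, E) M) := fun u ↦
  ((-(horizontalLift cov u ∘L J u.proj)).coprod (verticalLift u ∘L J u.proj)) ∘L parts cov u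

/-- `J₂ : X^H ↦ X^V, X^V ↦ -X^H`. -/
def liftJ₂ (cov : Connection 𝓘(ℝ, E) M) :
    EndField 𝓘(ℝ, E).tangent (TangentBundle 𝓘(ℝ, E) M) := fun u ↦
  ((verticalLift u).coprod (-(horizontalLift cov u))) ∘L parts cov u

/-- `J₃ : X^H ↦ (J X)^V, X^V ↦ (J X)^H`. -/
def liftJ₃ (cov : Connection 𝓘(ℝ, E) M) (J : EndField 𝓘(ℝ, E) M) :
    EndField 𝓘(ℝ, E).tangent (TangentBundle 𝓘(ℝ, E) M) := fun u ↦
  ((verticalLift u ∘L J u.proj).coprod (horizontalLift cov u ∘L J u.proj)) ∘L parts cov u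

/-- The complete lift of `g`: `ĝ(X^H, Y^H) = ĝ(X^V, Y^V) = 0`,
`ĝ(X^H, Y^V) = ĝ(X^V, Y^H) = g(X, Y)`, with horizontal lifts taken for `cov`. -/
def completeLift (cov : Connection 𝓘(ℝ, E) M) (g : FormField 𝓘(ℝ, E) M) :
    FormField 𝓘(ℝ, E).tangent (TangentBundle 𝓘(ℝ, E) M) := fun u ↦
  let gp : E →L[ℝ] E →L[ℝ] ℝ := g u.proj
  let hor : E × E →L[ℝ] E := ContinuousLinearMap.fst ℝ _ _ ∘L parts cov u
  let ver : E × E →L[ℝ] E := ContinuousLinearMap.snd ℝ _ _ ∘L parts cov u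
  (gp.bilinearComp hor ver + gp.bilinearComp ver hor : E × E →L[ℝ] E × E →L[ℝ] ℝ)

/-! The lifts decompose `T_u(TM)`, and the endomorphisms act on lifts as announced. -/

theorem trivialization_fibreInclusion (p : M) (w : E) :
    (trivializationAt E (TangentSpace 𝓘(ℝ, E)) p
      (TotalSpace.mk' E p w : TangentBundle 𝓘(ℝ, E) M)).2 = w := by
  have := TangentBundle.continuousLinearMapAt_trivializationAt_eq_core (I := 𝓘(ℝ,E)) (mem_chart_source E p)
  have h2 := (tangentBundleCore 𝓘(ℝ, E) M).coordChange_self (achart E p) p (by simp) w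
  exact h2

theorem mdifferentiableAt_fibreInclusion (p : M) (w : E) : MDifferentiableAt 𝓘(ℝ, E) 𝓘(ℝ, E).tangent
    (fun w : E ↦ (TotalSpace.mk' E p w : TangentBundle 𝓘(ℝ, E) M)) w := by
  have := mdifferentiableAt_totalSpace (IM := 𝓘(ℝ,E)) (IB := 𝓘(ℝ,E)) (F := E) (fun w : E ↦ (TotalSpace.mk' E p w : TangentBundle 𝓘(ℝ, E) M)) (x₀ := w)
  refine this.2 ?_
  refine ⟨mdifferentiableAt_const, ?_⟩
  simp only [trivialization_fibreInclusion]
  exact mdifferentiableAt_id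

theorem mdifferentiableAt_tangentProj (u : TangentBundle 𝓘(ℝ, E) M) : MDifferentiableAt 𝓘(ℝ, E).tangent 𝓘(ℝ, E)
    (TotalSpace.proj : TangentBundle 𝓘(ℝ, E) M → M) u :=
  Bundle.mdifferentiableAt_proj _

theorem mfderiv_proj_verticalLift (u : TangentBundle 𝓘(ℝ, E) M) (w) :
    mfderiv 𝓘(ℝ, E).tangent 𝓘(ℝ, E) (TotalSpace.proj : TangentBundle 𝓘(ℝ, E) M → M) u
      (verticalLift u w) = 0 := by
  have := mfderiv_comp (I := 𝓘(ℝ,E)) (M := E) (f := (fun w : E ↦ (TotalSpace.mk' E u.proj w : TangentBundle 𝓘(ℝ, E) M))) (show E from u.snd) (by exact mdifferentiableAt_tangentProj u) (mdifferentiableAt_fibreInclusion u.proj (show E from u.snd))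
  have h3 : (TotalSpace.proj : TangentBundle 𝓘(ℝ, E) M → M) ∘ (fun w : E ↦ (TotalSpace.mk' E u.proj w : TangentBundle 𝓘(ℝ, E) M)) = fun _ => u.proj := rfl
  rw [h3, mfderiv_const] at this
  exact (congrArg (fun L => L w) this).symm

theorem mfderiv_proj_horizontalLift (cov) (u : TangentBundle 𝓘(ℝ, E) M) (w) :
    mfderiv 𝓘(ℝ, E).tangent 𝓘(ℝ, E) (TotalSpace.proj : TangentBundle 𝓘(ℝ, E) M → M) u
      (horizontalLift cov u w) = w := by
  unfold horizontalLift
  have hs : MDifferentiableAt 𝓘(ℝ, E) 𝓘(ℝ, E).tangent  (fun x ↦ (TotalSpace.mk' E x (FiberBundle.extend E u.snd x) : TangentBundle 𝓘(ℝ, E) M)) u.proj := FiberBundle.mdifferentiableAt_extend ..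
  have hu : (TotalSpace.mk' E u.proj (FiberBundle.extend E u.snd u.proj) : TangentBundle 𝓘(ℝ, E) M) = u := by
    simp
  have := mfderiv_comp (I := 𝓘(ℝ,E)) (g := (TotalSpace.proj : TangentBundle 𝓘(ℝ, E) M → M)) u.proj (mdifferentiableAt_tangentProj _) hs
  have h3 : (TotalSpace.proj : TangentBundle 𝓘(ℝ, E) M → M) ∘ (fun x ↦ (TotalSpace.mk' E x (FiberBundle.extend E u.snd x) : TangentBundle 𝓘(ℝ, E) M)) = id := rfl
  rw [h3, mfderiv_id] at this
  have h4 := congrArg (fun L => L w) this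
  refine (map_sub _ _ _).trans ?_
  refine (congrArg₂ (· - ·) ?_ (mfderiv_proj_verticalLift u (cov (FiberBundle.extend E u.snd) u.proj w))).trans (sub_zero _)
  refine Eq.trans ?_ h4.symm
  let X : E × E := mfderiv 𝓘(ℝ, E) 𝓘(ℝ, E).tangent (fun x ↦
    (TotalSpace.mk' E x (FiberBundle.extend E u.snd x) : TangentBundle 𝓘(ℝ, E) M)) u.proj w
  let P : TangentBundle 𝓘(ℝ, E) M → E × E → E := fun q ↦
    mfderiv 𝓘(ℝ, E).tangent 𝓘(ℝ, E) (TotalSpace.proj : TangentBundle 𝓘(ℝ, E) M → M) q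
  exact congrArg (fun q ↦ P q X) hu.symm

theorem verticalLift_injective (u : TangentBundle 𝓘(ℝ, E) M) : Function.Injective (verticalLift u) := by
  have hd : MDifferentiableAt 𝓘(ℝ, E).tangent 𝓘(ℝ, E) (fun v : TangentBundle 𝓘(ℝ, E) M ↦ (trivializationAt E (TangentSpace 𝓘(ℝ, E)) u.proj v).2) u := by
    have := (mdifferentiableAt_totalSpace (IM := 𝓘(ℝ,E).tangent) (IB := 𝓘(ℝ,E)) (F := E) (fun v : TangentBundle 𝓘(ℝ, E) M ↦ v) (x₀ := u)).1 mdifferentiableAt_id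
    exact this.2
  have := mfderiv_comp (I := 𝓘(ℝ,E)) (M := E) (f := (fun w : E ↦ (TotalSpace.mk' E u.proj w : TangentBundle 𝓘(ℝ, E) M))) (show E from u.snd) (by exact hd) (mdifferentiableAt_fibreInclusion u.proj (show E from u.snd))
  have h3 : (fun v : TangentBundle 𝓘(ℝ, E) M ↦ (trivializationAt E (TangentSpace 𝓘(ℝ, E)) u.proj v).2) ∘ (fun w : E ↦ (TotalSpace.mk' E u.proj w : TangentBundle 𝓘(ℝ, E) M)) = id := by
    funext w; exact trivialization_fibreInclusion _ _
  rw [h3, mfderiv_id] at this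
  intro a b hab
  have ha := congrArg (fun L => L a) this
  have hb := congrArg (fun L => L b) this
  refine ha.trans (Eq.trans ?_ hb.symm)
  exact congrArg (mfderiv _ _ _ _) hab

theorem liftSum_isInvertible [FiniteDimensional ℝ E] (cov) (u : TangentBundle 𝓘(ℝ, E) M) :
    (liftSum cov u).IsInvertible := by
  let L : E × E →ₗ[ℝ] E × E :=
    { toFun := liftSum cov u, map_add' := (liftSum cov u).map_add,
      map_smul' := (liftSum cov u).map_smul }
  have key : ∀ a b : TangentSpace 𝓘(ℝ, E) u.proj,
      horizontalLift cov u a + verticalLift u b = 0 → a = 0 ∧ b = 0 := by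
    intro a b h
    have ha : a = 0 := by
      have := congrArg (mfderiv 𝓘(ℝ, E).tangent 𝓘(ℝ, E)
        (TotalSpace.proj : TangentBundle 𝓘(ℝ, E) M → M) u) h
      rw [map_add, mfderiv_proj_horizontalLift, mfderiv_proj_verticalLift, map_zero, add_zero] at this
      exact this
    subst ha
    rw [map_zero, zero_add] at h
    exact ⟨rfl, verticalLift_injective u (h.trans (map_zero _).symm)⟩
  have hinj : Function.Injective L := by
    refine (injective_iff_map_eq_zero L).2 ?_
    rintro ⟨a, b⟩ h
    exact Prod.ext (key a b h).1 (key a b h).2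
  exact ⟨(LinearEquiv.ofInjectiveEndo L hinj).toContinuousLinearEquiv (E := E × E) (F := E × E),
    ContinuousLinearMap.ext fun _ ↦ rfl⟩

theorem parts_horizontal [FiniteDimensional ℝ E] (cov) (u : TangentBundle 𝓘(ℝ, E) M) (a) :
    parts cov u (horizontalLift cov u a) = (a, 0) := by
  have := (liftSum_isInvertible cov u).inverse_apply_eq (x := (a,0)) (y := horizontalLift cov u a)
  refine this.2 ?_
  change _ = horizontalLift cov u a + verticalLift u 0
  rw [map_zero, add_zero]

theorem parts_vertical [FiniteDimensional ℝ E] (cov) (u : TangentBundle 𝓘(ℝ, E) M) (b) :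
    parts cov u (verticalLift u b) = (0, b) := by
  have := (liftSum_isInvertible cov u).inverse_apply_eq (x := (0,b)) (y := verticalLift u b)
  refine this.2 ?_
  change _ = horizontalLift cov u 0 + verticalLift u b
  rw [map_zero, zero_add]

theorem liftJ₁_horizontal [FiniteDimensional ℝ E] (cov) (J) (u : TangentBundle 𝓘(ℝ, E) M) (a) :
    liftJ₁ cov J u (horizontalLift cov u a) = -horizontalLift cov u (J u.proj a) := by
  change (ContinuousLinearMap.coprod _ _) (parts cov u (horizontalLift cov u a)) = _
  rw [parts_horizontal]; simp

theorem liftJ₁_vertical [FiniteDimensional ℝ E] (cov) (J) (u : TangentBundle 𝓘(ℝ, E) M) (a) :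
    liftJ₁ cov J u (verticalLift u a) = verticalLift u (J u.proj a) := by
  change (ContinuousLinearMap.coprod _ _) (parts cov u (verticalLift u a)) = _
  rw [parts_vertical]; simp

theorem liftJ₂_horizontal [FiniteDimensional ℝ E] (cov) (u : TangentBundle 𝓘(ℝ, E) M) (a) :
    liftJ₂ cov u (horizontalLift cov u a) = verticalLift u a := by
  change (ContinuousLinearMap.coprod _ _) (parts cov u (horizontalLift cov u a)) = _
  rw [parts_horizontal]; simp

theorem liftJ₂_vertical [FiniteDimensional ℝ E] (cov) (u : TangentBundle 𝓘(ℝ, E) M) (a) :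
    liftJ₂ cov u (verticalLift u a) = -horizontalLift cov u a := by
  change (ContinuousLinearMap.coprod _ _) (parts cov u (verticalLift u a)) = _
  rw [parts_vertical]; simp

theorem liftJ₃_horizontal [FiniteDimensional ℝ E] (cov) (J) (u : TangentBundle 𝓘(ℝ, E) M) (a) :
    liftJ₃ cov J u (horizontalLift cov u a) = verticalLift u (J u.proj a) := by
  change (ContinuousLinearMap.coprod _ _) (parts cov u (horizontalLift cov u a)) = _
  rw [parts_horizontal]; simp

theorem liftJ₃_vertical [FiniteDimensional ℝ E] (cov) (J) (u : TangentBundle 𝓘(ℝ, E) M) (a) :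
    liftJ₃ cov J u (verticalLift u a) = horizontalLift cov u (J u.proj a) := by
  change (ContinuousLinearMap.coprod _ _) (parts cov u (verticalLift u a)) = _
  rw [parts_vertical]; simp

theorem completeLift_apply (cov) (g) (u : TangentBundle 𝓘(ℝ, E) M)
    (v w : TangentSpace 𝓘(ℝ, E).tangent u) :
    completeLift cov g u v w =
      g u.proj (parts cov u v).1 (parts cov u w).2 +
        g u.proj (parts cov u v).2 (parts cov u w).1 := rfl

end Lifts

end NordenTangent

end

noncomputable section

/- In the moving frame of `TM` given by horizontal and vertical lifts, the connection form of the
complete lift at `w`, in the direction with horizontal part `c` and vertical part `d`, is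
`(a, b) ↦ (Γ(c, a), Γ(c, b) + R(w, c)a)`. The structures `Jᵢ` depend only on the base point there,
so the blocks of their covariant derivatives are expressed through `∇J` and `R`: they vanish for
`J₂` iff `R = 0`, for `J₃` iff `∇J = 0` and `JR = RJ = 0`, and for `J₁` iff `∇J = 0` and
`RJ + JR = 0`. In the last case `∇J = 0` makes `J` commute with `R`, so `2JR = 0`. For a
torsion-free connection a parallel almost complex structure has vanishing Nijenhuis tensor, which
settles integrability. -/

namespace NordenTangent

open scoped Topology

set_option maxSynthPendingDepth 3

section ChartCalculus

variable {F : Type*} [NormedAddCommGroup F] [NormedSpace ℝ F]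
  {H : Type*} [TopologicalSpace H] {I : ModelWithCorners ℝ F H}
  {N : Type*} [TopologicalSpace N] [ChartedSpace H N] [IsManifold I ∞ N]
  {G : Type*} [NormedAddCommGroup G] [NormedSpace ℝ G] {x₀ x : N} {z : F} {n : ℕ∞}

/-- The differential at `x` of the chart at `x₀`. It is encoded by the trivialization of the tangent
bundle at `x₀`, so it is an isomorphism on the chart domain and has the junk value `0` elsewhere. -/
def chartDeriv (I : ModelWithCorners ℝ F H) [IsManifold I ∞ N] (x₀ x : N) :
    TangentSpace I x →L[ℝ] F :=
  (trivializationAt F (TangentSpace I) x₀).continuousLinearMapAt ℝ x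

/-- The inverse of the differential at `x` of the chart at `x₀`, for `x` in the chart domain. -/
def chartDerivSymm (I : ModelWithCorners ℝ F H) [IsManifold I ∞ N] (x₀ x : N) :
    F →L[ℝ] TangentSpace I x :=
  (trivializationAt F (TangentSpace I) x₀).symmL ℝ x

theorem mem_baseSet_of_mem_extChartAt_source (hx : x ∈ (extChartAt I x₀).source) :
    x ∈ (trivializationAt F (TangentSpace I) x₀).baseSet := by
  rwa [extChartAt_source] at hx

theorem chartDeriv_chartDerivSymm (hx : x ∈ (extChartAt I x₀).source) (v : F) :
    chartDeriv I x₀ x (chartDerivSymm I x₀ x v) = v :=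
  Trivialization.continuousLinearMapAt_symmL _ (mem_baseSet_of_mem_extChartAt_source hx) v

theorem chartDerivSymm_chartDeriv (hx : x ∈ (extChartAt I x₀).source) (v : TangentSpace I x) :
    chartDerivSymm I x₀ x (chartDeriv I x₀ x v) = v :=
  Trivialization.symmL_continuousLinearMapAt _ (mem_baseSet_of_mem_extChartAt_source hx) v

theorem chartDeriv_injective (hx : x ∈ (extChartAt I x₀).source) :
    Function.Injective (chartDeriv I x₀ x) :=
  Function.LeftInverse.injective (chartDerivSymm_chartDeriv hx)

theorem chartDeriv_eq_mfderiv (hx : x ∈ (extChartAt I x₀).source) :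
    chartDeriv I x₀ x = mfderiv I 𝓘(ℝ, F) (extChartAt I x₀) x :=
  TangentBundle.continuousLinearMapAt_trivializationAt (extChartAt_source I x₀ ▸ hx)

theorem mfderiv_extChartAt_inverse_apply (hx : x ∈ (extChartAt I x₀).source) (v : F) :
    (mfderiv I 𝓘(ℝ, F) (extChartAt I x₀) x).inverse v = chartDerivSymm I x₀ x v := by
  let e : TangentSpace I x ≃L[ℝ] F := ContinuousLinearEquiv.equivOfInverse (chartDeriv I x₀ x)
    (chartDerivSymm I x₀ x) (chartDerivSymm_chartDeriv hx) (chartDeriv_chartDerivSymm hx)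
  have h : mfderiv I 𝓘(ℝ, F) (extChartAt I x₀) x = (e : TangentSpace I x →L[ℝ] F) :=
    (chartDeriv_eq_mfderiv hx).symm
  rw [h]
  exact congrArg (fun L ↦ L v) (ContinuousLinearMap.inverse_equiv e)

theorem trivializationAt_snd (hx : x ∈ (extChartAt I x₀).source) (v : TangentSpace I x) :
    (trivializationAt F (TangentSpace I) x₀ (TotalSpace.mk' F x v)).2 = chartDeriv I x₀ x v :=
  (Trivialization.continuousLinearMapAt_apply_of_mem ℝ _
    (mem_baseSet_of_mem_extChartAt_source hx) v).symm

theorem trivializationAt_snd_eventuallyEq (hx : x ∈ (extChartAt I x₀).source)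
    (Y : ∀ x : N, TangentSpace I x) :
    (fun y ↦ (trivializationAt F (TangentSpace I) x₀ (TotalSpace.mk' F y (Y y))).2) =ᶠ[𝓝 x]
      fun y ↦ chartDeriv I x₀ y (Y y) := by
  filter_upwards [extChartAt_source_mem_nhds' hx] with y hy
  exact trivializationAt_snd hy _

theorem contMDiffAt_section_iff_chartDeriv (hx : x ∈ (extChartAt I x₀).source)
    {Y : ∀ x : N, TangentSpace I x} :
    ContMDiffAt I (I.prod 𝓘(ℝ, F)) n (fun y ↦ TotalSpace.mk' F y (Y y)) x ↔
      ContMDiffAt I 𝓘(ℝ, F) n (fun y ↦ chartDeriv I x₀ y (Y y)) x := by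
  have : IsManifold I (n + 1) N := .of_le (n := ∞) (by exact_mod_cast le_top)
  have := TangentBundle.contMDiffVectorBundle (I := I) (M := N) (n := n)
  rw [Trivialization.contMDiffAt_section_iff (trivializationAt F (TangentSpace I) x₀)
    (mem_baseSet_of_mem_extChartAt_source hx)]
  exact (trivializationAt_snd_eventuallyEq hx Y).contMDiffAt_iff

theorem mdifferentiableAt_section_iff_chartDeriv (hx : x ∈ (extChartAt I x₀).source)
    {Y : ∀ x : N, TangentSpace I x} :
    MDifferentiableAt I (I.prod 𝓘(ℝ, F)) (fun y ↦ TotalSpace.mk' F y (Y y)) x ↔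
      MDifferentiableAt I 𝓘(ℝ, F) (fun y ↦ chartDeriv I x₀ y (Y y)) x := by
  rw [Trivialization.mdifferentiableAt_section_iff I (trivializationAt F (TangentSpace I) x₀) Y
    (mem_baseSet_of_mem_extChartAt_source hx)]
  exact (trivializationAt_snd_eventuallyEq hx Y).mdifferentiableAt_iff

theorem contMDiffAt_comp_extChartAt (hx : x ∈ (extChartAt I x₀).source) {f : F → G}
    (hf : ContDiffAt ℝ n f (extChartAt I x₀ x)) :
    ContMDiffAt I 𝓘(ℝ, G) n (fun y ↦ f (extChartAt I x₀ y)) x :=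
  ContMDiffAt.comp (I' := 𝓘(ℝ, F)) (g := f) _ hf.contMDiffAt
    ((contMDiffAt_extChartAt' (n := ∞) (extChartAt_source I x₀ ▸ hx)).of_le
      (by exact_mod_cast le_top))

theorem mdifferentiableAt_comp_extChartAt (hx : x ∈ (extChartAt I x₀).source) {f : F → G}
    (hf : DifferentiableAt ℝ f (extChartAt I x₀ x)) :
    MDifferentiableAt I 𝓘(ℝ, G) (fun y ↦ f (extChartAt I x₀ y)) x :=
  MDifferentiableAt.comp (I' := 𝓘(ℝ, F)) (g := f) _ hf.mdifferentiableAt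
    ((contMDiffAt_extChartAt' (n := ∞) (extChartAt_source I x₀ ▸ hx)).mdifferentiableAt (by simp))

/-- The coordinate expression of a vector field in the chart at `x₀`. -/
def fieldInChart (x₀ : N) (Y : ∀ x : N, TangentSpace I x) (z : F) : F :=
  chartDeriv I x₀ ((extChartAt I x₀).symm z) (Y ((extChartAt I x₀).symm z))

/-- The vector field with a given coordinate expression in the chart at `x₀`. -/
def fieldOfChart (I : ModelWithCorners ℝ F H) [IsManifold I ∞ N] (x₀ : N) (W : F → F) (x : N) :
    TangentSpace I x :=
  chartDerivSymm I x₀ x (W (extChartAt I x₀ x))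

theorem fieldInChart_extChartAt (hx : x ∈ (extChartAt I x₀).source)
    (Y : ∀ x : N, TangentSpace I x) :
    fieldInChart x₀ Y (extChartAt I x₀ x) = chartDeriv I x₀ x (Y x) := by
  rw [fieldInChart, (extChartAt I x₀).left_inv hx]

theorem fieldInChart_fieldOfChart (hz : z ∈ (extChartAt I x₀).target) (W : F → F) :
    fieldInChart x₀ (fieldOfChart I x₀ W) z = W z := by
  rw [fieldInChart, fieldOfChart, chartDeriv_chartDerivSymm ((extChartAt I x₀).map_target hz),
    (extChartAt I x₀).right_inv hz]

theorem mdifferentiableAt_of_fieldInChart (hx : x ∈ (extChartAt I x₀).source)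
    {Y : ∀ x : N, TangentSpace I x}
    (hY : DifferentiableAt ℝ (fieldInChart x₀ Y) (extChartAt I x₀ x)) :
    MDifferentiableAt I (I.prod 𝓘(ℝ, F)) (fun y ↦ TotalSpace.mk' F y (Y y)) x := by
  refine (mdifferentiableAt_section_iff_chartDeriv hx).2 <|
    (mdifferentiableAt_comp_extChartAt hx hY).congr_of_eventuallyEq ?_
  filter_upwards [extChartAt_source_mem_nhds' hx] with y hy
  exact (fieldInChart_extChartAt hy Y).symm

theorem chartDeriv_fieldOfChart_eventuallyEq (hx : x ∈ (extChartAt I x₀).source) (W : F → F) :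
    (fun y ↦ chartDeriv I x₀ y (fieldOfChart I x₀ W y)) =ᶠ[𝓝 x]
      fun y ↦ W (extChartAt I x₀ y) := by
  filter_upwards [extChartAt_source_mem_nhds' hx] with y hy
  exact chartDeriv_chartDerivSymm hy _

theorem contMDiffAt_fieldOfChart (hx : x ∈ (extChartAt I x₀).source) {W : F → F}
    (hW : ContDiffAt ℝ n W (extChartAt I x₀ x)) :
    ContMDiffAt I (I.prod 𝓘(ℝ, F)) n (fun y ↦ TotalSpace.mk' F y (fieldOfChart I x₀ W y)) x :=
  (contMDiffAt_section_iff_chartDeriv hx).2 <|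
    (contMDiffAt_comp_extChartAt hx hW).congr_of_eventuallyEq
      (chartDeriv_fieldOfChart_eventuallyEq hx W)

theorem mdifferentiableAt_fieldOfChart (hx : x ∈ (extChartAt I x₀).source) {W : F → F}
    (hW : DifferentiableAt ℝ W (extChartAt I x₀ x)) :
    MDifferentiableAt I (I.prod 𝓘(ℝ, F)) (fun y ↦ TotalSpace.mk' F y (fieldOfChart I x₀ W y)) x :=
  (mdifferentiableAt_section_iff_chartDeriv hx).2 <|
    (mdifferentiableAt_comp_extChartAt hx hW).congr_of_eventuallyEq
      (chartDeriv_fieldOfChart_eventuallyEq hx W)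

theorem mlieBracket_eq_lieBracket (V W : ∀ z : F, TangentSpace 𝓘(ℝ, F) z) :
    VectorField.mlieBracket 𝓘(ℝ, F) V W = VectorField.lieBracket ℝ V W := by
  rw [← VectorField.mlieBracketWithin_univ, VectorField.mlieBracketWithin_eq_lieBracketWithin]
  exact VectorField.lieBracketWithin_univ

theorem mpullback_fieldInChart_eventuallyEq (hx : x ∈ (extChartAt I x₀).source)
    (Y : ∀ x : N, TangentSpace I x) :
    VectorField.mpullback I 𝓘(ℝ, F) (extChartAt I x₀)
      (fun z : F ↦ fieldInChart (F := F) x₀ Y z) =ᶠ[𝓝 x] Y := by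
  filter_upwards [extChartAt_source_mem_nhds' hx] with y hy
  refine (mfderiv_extChartAt_inverse_apply hy _).trans ?_
  exact (congrArg _ (fieldInChart_extChartAt hy Y)).trans (chartDerivSymm_chartDeriv hy _)

section Boundaryless

variable [I.Boundaryless]

theorem contDiffAt_comp_extChartAt_symm (hx : x ∈ (extChartAt I x₀).source) {f : N → G}
    (hf : ContMDiffAt I 𝓘(ℝ, G) n f x) :
    ContDiffAt ℝ n (fun z ↦ f ((extChartAt I x₀).symm z)) (extChartAt I x₀ x) := by
  rw [← contMDiffAt_iff_contDiffAt]
  have hsymm := (contMDiffOn_extChartAt_symm (n := ∞) x₀).contMDiffAt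
    (extChartAt_target_mem_nhds' ((extChartAt I x₀).map_source hx))
  refine ContMDiffAt.comp (I' := I) (g := f) _ ?_ (hsymm.of_le (by exact_mod_cast le_top))
  rwa [(extChartAt I x₀).left_inv hx]

theorem differentiableAt_comp_extChartAt_symm (hx : x ∈ (extChartAt I x₀).source) {f : N → G}
    (hf : MDifferentiableAt I 𝓘(ℝ, G) f x) :
    DifferentiableAt ℝ (fun z ↦ f ((extChartAt I x₀).symm z)) (extChartAt I x₀ x) := by
  rw [← mdifferentiableAt_iff_differentiableAt]
  have hsymm := (contMDiffOn_extChartAt_symm (n := ∞) x₀).contMDiffAt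
    (extChartAt_target_mem_nhds' ((extChartAt I x₀).map_source hx))
  refine MDifferentiableAt.comp (I' := I) (g := f) _ ?_ (hsymm.mdifferentiableAt (by simp))
  rwa [(extChartAt I x₀).left_inv hx]

theorem mvfderiv_eq_fderiv_chartDeriv (hx : x ∈ (extChartAt I x₀).source) {f : N → G}
    (hf : MDifferentiableAt I 𝓘(ℝ, G) f x) (v : TangentSpace I x) :
    mvfderiv I f x v =
      fderiv ℝ (fun z ↦ f ((extChartAt I x₀).symm z)) (extChartAt I x₀ x)
        (chartDeriv I x₀ x v) := by
  have hd := differentiableAt_comp_extChartAt_symm hx hf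
  have h := mfderiv_comp (I' := 𝓘(ℝ, F)) (I'' := 𝓘(ℝ, G)) x hd.mdifferentiableAt
    (mdifferentiableAt_extChartAt (I := I) (extChartAt_source I x₀ ▸ hx))
  have he : (fun z ↦ f ((extChartAt I x₀).symm z)) ∘ extChartAt I x₀ =ᶠ[𝓝 x] f := by
    filter_upwards [extChartAt_source_mem_nhds' hx] with y hy
    rw [Function.comp_apply, (extChartAt I x₀).left_inv hy]
  rw [he.mfderiv_eq, mfderiv_eq_fderiv] at h
  rw [chartDeriv_eq_mfderiv hx]
  exact congrArg (fun L ↦ L v) h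

theorem contDiffAt_fieldInChart (hx : x ∈ (extChartAt I x₀).source)
    {Y : ∀ x : N, TangentSpace I x}
    (hY : ContMDiffAt I (I.prod 𝓘(ℝ, F)) n (fun y ↦ TotalSpace.mk' F y (Y y)) x) :
    ContDiffAt ℝ n (fieldInChart x₀ Y) (extChartAt I x₀ x) :=
  contDiffAt_comp_extChartAt_symm hx ((contMDiffAt_section_iff_chartDeriv hx).1 hY)

theorem differentiableAt_fieldInChart (hx : x ∈ (extChartAt I x₀).source)
    {Y : ∀ x : N, TangentSpace I x}
    (hY : MDifferentiableAt I (I.prod 𝓘(ℝ, F)) (fun y ↦ TotalSpace.mk' F y (Y y)) x) :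
    DifferentiableAt ℝ (fieldInChart x₀ Y) (extChartAt I x₀ x) :=
  differentiableAt_comp_extChartAt_symm hx ((mdifferentiableAt_section_iff_chartDeriv hx).1 hY)

theorem mdifferentiableAt_fieldInChart (hx : x ∈ (extChartAt I x₀).source)
    {Y : ∀ x : N, TangentSpace I x}
    (hY : MDifferentiableAt I (I.prod 𝓘(ℝ, F)) (fun y ↦ TotalSpace.mk' F y (Y y)) x) :
    MDifferentiableAt 𝓘(ℝ, F) 𝓘(ℝ, F).tangent
      (fun z ↦ (TotalSpace.mk' F z (fieldInChart (F := F) x₀ Y z) : TangentBundle 𝓘(ℝ, F) F))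
      (extChartAt I x₀ x) := by
  refine (mdifferentiableAt_section_iff_chartDeriv (mem_extChartAt_source _)).2 ?_
  refine (differentiableAt_fieldInChart hx hY).mdifferentiableAt.congr_of_eventuallyEq
    (Filter.Eventually.of_forall fun z ↦ ?_)
  exact congrArg (fun L : F →L[ℝ] F ↦ L (fieldInChart x₀ Y z))
    (TangentBundle.continuousLinearMapAt_model_space (extChartAt I x₀ x) z)

theorem chartDeriv_mlieBracket [CompleteSpace F] (hx : x ∈ (extChartAt I x₀).source)
    {X Y : ∀ x : N, TangentSpace I x}
    (hX : MDifferentiableAt I (I.prod 𝓘(ℝ, F)) (fun y ↦ TotalSpace.mk' F y (X y)) x)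
    (hY : MDifferentiableAt I (I.prod 𝓘(ℝ, F)) (fun y ↦ TotalSpace.mk' F y (Y y)) x) :
    chartDeriv I x₀ x (VectorField.mlieBracket I X Y x) =
      VectorField.lieBracket ℝ (fieldInChart x₀ X) (fieldInChart x₀ Y) (extChartAt I x₀ x) := by
  have hsmooth : minSmoothness ℝ 3 ≤ (∞ : WithTop ℕ∞) := by
    rw [minSmoothness_of_isRCLikeNormedField]; exact ENat.LEInfty.out
  have : IsManifold I (minSmoothness ℝ 3) N := .of_le hsmooth
  have hpull := VectorField.mpullback_mlieBracket (n := ∞) (mdifferentiableAt_fieldInChart hx hX)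
    (mdifferentiableAt_fieldInChart hx hY)
    (contMDiffAt_extChartAt' (I := I) (extChartAt_source I x₀ ▸ hx))
    (by rw [minSmoothness_of_isRCLikeNormedField]; exact ENat.LEInfty.out)
  rw [Filter.EventuallyEq.mlieBracket_vectorField_eq
    (mpullback_fieldInChart_eventuallyEq hx X) (mpullback_fieldInChart_eventuallyEq hx Y)] at hpull
  rw [← hpull]
  refine (congrArg (chartDeriv I x₀ x) (mfderiv_extChartAt_inverse_apply hx _)).trans ?_
  exact (chartDeriv_chartDerivSymm hx _).trans (congrFun (mlieBracket_eq_lieBracket _ _) _)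

end Boundaryless

end ChartCalculus

section TensorsInCharts

variable {F : Type*} [NormedAddCommGroup F] [NormedSpace ℝ F]
  {H : Type*} [TopologicalSpace H] {I : ModelWithCorners ℝ F H}
  {N : Type*} [TopologicalSpace N] [ChartedSpace H N] [IsManifold I ∞ N]
  {x₀ x : N} {z : F}

/-- The coordinate expression of a field of endomorphisms in the chart at `x₀`. -/
def endInChart (x₀ : N) (J : EndField I N) (z : F) : F →L[ℝ] F :=
  chartDeriv I x₀ ((extChartAt I x₀).symm z) ∘L J ((extChartAt I x₀).symm z) ∘L
    chartDerivSymm I x₀ ((extChartAt I x₀).symm z)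

/-- The coordinate expression of a field of bilinear forms in the chart at `x₀`. -/
def formInChart (x₀ : N) (g : FormField I N) (z : F) : F →L[ℝ] F →L[ℝ] ℝ :=
  let gz : F →L[ℝ] F →L[ℝ] ℝ := g ((extChartAt I x₀).symm z)
  let S : F →L[ℝ] F := chartDerivSymm I x₀ ((extChartAt I x₀).symm z)
  gz.bilinearComp S S

theorem endInChart_apply (J : EndField I N) (v : F) :
    endInChart x₀ J z v = chartDeriv I x₀ ((extChartAt I x₀).symm z) (J ((extChartAt I x₀).symm z)
      (chartDerivSymm I x₀ ((extChartAt I x₀).symm z) v)) := rfl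

theorem formInChart_apply (g : FormField I N) (v w : F) :
    formInChart x₀ g z v w = g ((extChartAt I x₀).symm z)
      (chartDerivSymm I x₀ ((extChartAt I x₀).symm z) v)
      (chartDerivSymm I x₀ ((extChartAt I x₀).symm z) w) := rfl

theorem endInChart_extChartAt (hx : x ∈ (extChartAt I x₀).source) (J : EndField I N) (v : F) :
    endInChart x₀ J (extChartAt I x₀ x) v =
      chartDeriv I x₀ x (J x (chartDerivSymm I x₀ x v)) := by
  rw [endInChart_apply, (extChartAt I x₀).left_inv hx]

theorem formInChart_extChartAt (hx : x ∈ (extChartAt I x₀).source) (g : FormField I N) (v w : F) :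
    formInChart x₀ g (extChartAt I x₀ x) v w =
      g x (chartDerivSymm I x₀ x v) (chartDerivSymm I x₀ x w) := by
  rw [formInChart_apply, (extChartAt I x₀).left_inv hx]

theorem endInChart_extChartAt_chartDeriv (hx : x ∈ (extChartAt I x₀).source) (J : EndField I N)
    (v : TangentSpace I x) :
    endInChart x₀ J (extChartAt I x₀ x) (chartDeriv I x₀ x v) = chartDeriv I x₀ x (J x v) := by
  rw [endInChart_extChartAt hx, chartDerivSymm_chartDeriv hx]

theorem formInChart_extChartAt_chartDeriv (hx : x ∈ (extChartAt I x₀).source) (g : FormField I N)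
    (v w : TangentSpace I x) :
    formInChart x₀ g (extChartAt I x₀ x) (chartDeriv I x₀ x v) (chartDeriv I x₀ x w) =
      g x v w := by
  rw [formInChart_extChartAt hx, chartDerivSymm_chartDeriv hx, chartDerivSymm_chartDeriv hx]

theorem fieldInChart_endField_apply (hz : z ∈ (extChartAt I x₀).target) (J : EndField I N)
    (Y : ∀ x : N, TangentSpace I x) :
    fieldInChart x₀ (fun y ↦ J y (Y y)) z = endInChart x₀ J z (fieldInChart x₀ Y z) := by
  rw [endInChart_apply, fieldInChart, fieldInChart,
    chartDerivSymm_chartDeriv ((extChartAt I x₀).map_target hz)]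

theorem formInChart_fieldInChart (hz : z ∈ (extChartAt I x₀).target) (g : FormField I N)
    (Y Z : ∀ x : N, TangentSpace I x) :
    formInChart x₀ g z (fieldInChart x₀ Y z) (fieldInChart x₀ Z z) =
      g ((extChartAt I x₀).symm z) (Y ((extChartAt I x₀).symm z))
        (Z ((extChartAt I x₀).symm z)) := by
  have hx := (extChartAt I x₀).map_target hz
  rw [formInChart_apply, fieldInChart, fieldInChart, chartDerivSymm_chartDeriv hx,
    chartDerivSymm_chartDeriv hx]

/-- Smoothness of a field of endomorphisms, as a section of the bundle of endomorphisms. -/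
abbrev SmoothEnd (J : EndField I N) : Prop :=
  ContMDiff I (I.prod 𝓘(ℝ, F →L[ℝ] F)) ∞ (fun x ↦ TotalSpace.mk' (F →L[ℝ] F)
    (E := fun x : N ↦ TangentSpace I x →L[ℝ] TangentSpace I x) x (J x))

/-- Smoothness of a field of bilinear forms, as a section of the bundle of bilinear forms. -/
abbrev SmoothForm (g : FormField I N) : Prop :=
  ContMDiff I (I.prod 𝓘(ℝ, F →L[ℝ] F →L[ℝ] ℝ)) ∞ (fun x ↦ TotalSpace.mk' (F →L[ℝ] F →L[ℝ] ℝ)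
    (E := fun x : N ↦ TangentSpace I x →L[ℝ] TangentSpace I x →L[ℝ] ℝ) x (g x))

theorem smoothEnd_of_contDiffAt_endInChart {J : EndField I N}
    (h : ∀ x₀ : N, ContDiffAt ℝ ∞ (endInChart x₀ J) (extChartAt I x₀ x₀)) : SmoothEnd J := by
  intro x₀
  have hx₀ := mem_extChartAt_source (I := I) x₀
  rw [contMDiffAt_hom_bundle]
  refine ⟨contMDiffAt_id,
    (contMDiffAt_comp_extChartAt (n := ⊤) hx₀ (h x₀)).congr_of_eventuallyEq ?_⟩
  filter_upwards [extChartAt_source_mem_nhds' hx₀] with y hy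
  ext v
  rw [endInChart_extChartAt hy]
  rfl

theorem smoothForm_of_contDiffAt_formInChart {g : FormField I N}
    (h : ∀ x₀ : N, ContDiffAt ℝ ∞ (formInChart x₀ g) (extChartAt I x₀ x₀)) : SmoothForm g := by
  intro x₀
  have hx₀ := mem_extChartAt_source (I := I) x₀
  rw [contMDiffAt_hom_bundle]
  refine ⟨contMDiffAt_id,
    (contMDiffAt_comp_extChartAt (n := ⊤) hx₀ (h x₀)).congr_of_eventuallyEq ?_⟩
  filter_upwards [extChartAt_source_mem_nhds' hx₀] with y hy
  have hy' := mem_baseSet_of_mem_extChartAt_source hy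
  ext v w
  rw [formInChart_extChartAt hy]
  refine (inCoordinates_apply_eq₂ (E₃ := fun _ : N ↦ ℝ) hy' hy' (by simp)).trans ?_
  have hsymm (v : F) :
      chartDerivSymm I x₀ y v = (trivializationAt F (TangentSpace I) x₀).symm y v :=
    Trivialization.symmL_apply (R := ℝ) _ hy' v
  rw [hsymm, hsymm]
  exact congrArg (fun L : ℝ →ₗ[ℝ] ℝ ↦ L _) (Bundle.Trivial.linearMapAt_trivialization ℝ N ℝ y)

variable [I.Boundaryless] [FiniteDimensional ℝ F]

theorem contDiffOn_endInChart {J : EndField I N} (hJ : SmoothEnd J) (x₀ : N) :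
    ContDiffOn ℝ ∞ (endInChart x₀ J) (extChartAt I x₀).target := by
  rw [contDiffOn_clm_apply]
  intro v z hz
  have hx := (extChartAt I x₀).map_target hz
  have h := contDiffAt_fieldInChart hx ((hJ ((extChartAt I x₀).symm z)).clm_bundle_apply
    (contMDiffAt_fieldOfChart (n := ⊤) hx (contDiffAt_const (c := v))))
  rw [(extChartAt I x₀).right_inv hz] at h
  refine (h.congr_of_eventuallyEq ?_).contDiffWithinAt
  filter_upwards [extChartAt_target_mem_nhds' hz] with y hy
  rw [fieldInChart_endField_apply hy, fieldInChart_fieldOfChart hy]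

theorem contDiffOn_formInChart {g : FormField I N} (hg : SmoothForm g) (x₀ : N) :
    ContDiffOn ℝ ∞ (formInChart x₀ g) (extChartAt I x₀).target := by
  rw [contDiffOn_clm_apply]
  intro v
  rw [contDiffOn_clm_apply]
  intro w z hz
  have hx := (extChartAt I x₀).map_target hz
  have hsection := ContMDiffAt.clm_bundle_apply₂ (E₃ := fun _ : N ↦ ℝ)
    (hg ((extChartAt I x₀).symm z))
    (contMDiffAt_fieldOfChart (n := ⊤) hx (contDiffAt_const (c := v)))
    (contMDiffAt_fieldOfChart (n := ⊤) hx (contDiffAt_const (c := w)))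
  have hfun : ContMDiffAt I 𝓘(ℝ, ℝ) ∞
      (fun y ↦ g y (fieldOfChart I x₀ (fun _ ↦ v) y) (fieldOfChart I x₀ (fun _ ↦ w) y))
      ((extChartAt I x₀).symm z) := (contMDiffAt_totalSpace.1 hsection).2
  have hcoord := contDiffAt_comp_extChartAt_symm (n := ⊤) hx hfun
  rw [(extChartAt I x₀).right_inv hz] at hcoord
  refine (hcoord.congr_of_eventuallyEq ?_).contDiffWithinAt
  filter_upwards [extChartAt_target_mem_nhds' hz] with y hy
  rw [← formInChart_fieldInChart hy, fieldInChart_fieldOfChart hy, fieldInChart_fieldOfChart hy]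

end TensorsInCharts

section DerivativesOfOperators

variable {X Y A B G : Type*} [NormedAddCommGroup X] [NormedSpace ℝ X]
  [NormedAddCommGroup Y] [NormedSpace ℝ Y] [NormedAddCommGroup A] [NormedSpace ℝ A]
  [NormedAddCommGroup B] [NormedSpace ℝ B] [NormedAddCommGroup G] [NormedSpace ℝ G] {x : X}

theorem fderiv_clm_apply_const {L : X → A →L[ℝ] G} (hL : DifferentiableAt ℝ L x) (v : X) (a : A) :
    fderiv ℝ (fun y ↦ L y a) x v = fderiv ℝ L x v a := by
  rw [(hL.hasFDerivAt.clm_apply (hasFDerivAt_const a x)).fderiv]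
  simp

theorem fderiv_bilinear_symm {β : X → A →L[ℝ] A →L[ℝ] G} (hβ : DifferentiableAt ℝ β x)
    (hs : ∀ᶠ y in 𝓝 x, ∀ a b, β y a b = β y b a) (v : X) (a b : A) :
    fderiv ℝ β x v a b = fderiv ℝ β x v b a := by
  have hβa (a : A) : DifferentiableAt ℝ (fun y ↦ β y a) x :=
    hβ.clm_apply (differentiableAt_const a)
  have hswap : (fun y ↦ β y a b) =ᶠ[𝓝 x] fun y ↦ β y b a := hs.mono fun _ hy ↦ hy a b
  rw [← fderiv_clm_apply_const hβ, ← fderiv_clm_apply_const (hβa a), hswap.fderiv_eq,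
    fderiv_clm_apply_const (hβa b), fderiv_clm_apply_const hβ]

theorem fderiv_bilinear_apply {β : X → A →L[ℝ] B →L[ℝ] G} {f : X → A} {h : X → B}
    (hβ : DifferentiableAt ℝ β x) (hf : DifferentiableAt ℝ f x) (hh : DifferentiableAt ℝ h x)
    (v : X) :
    fderiv ℝ (fun y ↦ β y (f y) (h y)) x v =
      fderiv ℝ β x v (f x) (h x) + β x (fderiv ℝ f x v) (h x) + β x (f x) (fderiv ℝ h x v) := by
  rw [((hβ.hasFDerivAt.clm_apply hf.hasFDerivAt).clm_apply hh.hasFDerivAt).fderiv]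
  simp only [add_apply, ContinuousLinearMap.comp_apply, ContinuousLinearMap.flip_apply]
  abel

theorem contDiffAt_clm_comp_fst {n : WithTop ℕ∞} {p : X × Y} (L : A →L[ℝ] G) {f : X → A}
    (hf : ContDiffAt ℝ n f p.1) : ContDiffAt ℝ n (fun q : X × Y ↦ L (f q.1)) p :=
  L.contDiff.contDiffAt.comp p (hf.comp p contDiffAt_fst)

theorem fderiv_clm_comp_fst_apply {p : X × Y} (L : A →L[ℝ] G) {f : X → A}
    (hf : DifferentiableAt ℝ f p.1) (V : X × Y) :
    fderiv ℝ (fun q : X × Y ↦ L (f q.1)) p V = L (fderiv ℝ f p.1 V.1) :=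
  DFunLike.congr_fun (L.hasFDerivAt.comp p (hf.hasFDerivAt.comp p hasFDerivAt_fst)).fderiv V

end DerivativesOfOperators

section LocalConnection

variable {F : Type*} [NormedAddCommGroup F] [NormedSpace ℝ F]
  {G : Type*} [NormedAddCommGroup G] [NormedSpace ℝ G]
  {Γ : F → F →L[ℝ] G →L[ℝ] G} {S : F → G →L[ℝ] G} {z : F}

/-- The covariant derivative of a section `Y` of the trivial bundle with fibre `G`, for the
connection with connection form `Γ`. -/
def localCov (Γ : F → F →L[ℝ] G →L[ℝ] G) (Y : F → G) (z : F) : F →L[ℝ] G :=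
  fderiv ℝ Y z + (Γ z).flip (Y z)

theorem localCov_apply (Γ : F → F →L[ℝ] G →L[ℝ] G) (Y : F → G) (z v : F) :
    localCov Γ Y z v = fderiv ℝ Y z v + Γ z v (Y z) := rfl

/-- The curvature of the connection with connection form `Γ`. -/
def localCurvature (Γ : F → F →L[ℝ] G →L[ℝ] G) (z a b : F) (c : G) : G :=
  fderiv ℝ Γ z a b c - fderiv ℝ Γ z b a c + Γ z a (Γ z b c) - Γ z b (Γ z a c)

/-- The covariant derivative of a field `S` of endomorphisms of the fibre, for the connection with
connection form `Γ`. -/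
def localDerivEnd (Γ : F → F →L[ℝ] G →L[ℝ] G) (S : F → G →L[ℝ] G) (z a : F) (c : G) : G :=
  fderiv ℝ S z a c + Γ z a (S z c) - S z (Γ z a c)

theorem localCurvature_neg (Γ : F → F →L[ℝ] G →L[ℝ] G) (z a b : F) (c : G) :
    localCurvature Γ z a b (-c) = -localCurvature Γ z a b c := by
  simp only [localCurvature, map_neg]
  abel

theorem localCurvature_zero (Γ : F → F →L[ℝ] G →L[ℝ] G) (z a b : F) :
    localCurvature Γ z a b 0 = 0 := by
  simp [localCurvature]

theorem localDerivEnd_zero_right (Γ : F → F →L[ℝ] G →L[ℝ] G) (S : F → G →L[ℝ] G) (z v : F) :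
    localDerivEnd Γ S z v 0 = 0 := by
  simp [localDerivEnd]

theorem localDerivEnd_congr {S' : F → G →L[ℝ] G} (h : S =ᶠ[𝓝 z] S') (v : F) (c : G) :
    localDerivEnd Γ S z v c = localDerivEnd Γ S' z v c := by
  rw [localDerivEnd, localDerivEnd, h.fderiv_eq, h.self_of_nhds]

theorem localCov_congr {Y Y' : F → G} (h : Y =ᶠ[𝓝 z] Y') :
    localCov Γ Y z = localCov Γ Y' z := by
  rw [localCov, localCov, h.fderiv_eq, h.eq_of_nhds]

theorem localCov_const (Γ : F → F →L[ℝ] G →L[ℝ] G) (c : G) (z v : F) :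
    localCov Γ (fun _ ↦ c) z v = Γ z v c := by
  rw [localCov_apply, fderiv_fun_const, Pi.zero_apply, zero_apply, zero_add]

theorem localCov_add {Y Y' : F → G} (hY : DifferentiableAt ℝ Y z) (hY' : DifferentiableAt ℝ Y' z)
    (v : F) :
    localCov Γ (fun y ↦ Y y + Y' y) z v = localCov Γ Y z v + localCov Γ Y' z v := by
  simp only [localCov_apply, fderiv_fun_add hY hY', add_apply, map_add]
  abel

theorem localCov_smul {f : F → ℝ} {Y : F → G} (hf : DifferentiableAt ℝ f z)
    (hY : DifferentiableAt ℝ Y z) (v : F) :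
    localCov Γ (fun y ↦ f y • Y y) z v = f z • localCov Γ Y z v + fderiv ℝ f z v • Y z := by
  simp only [localCov_apply, fderiv_fun_smul hf hY, add_apply, smul_apply, map_smul,
    ContinuousLinearMap.smulRight_apply]
  module

theorem localCov_endField_apply {Y : F → G} (hS : DifferentiableAt ℝ S z)
    (hY : DifferentiableAt ℝ Y z) (v : F) :
    localCov Γ (fun y ↦ S y (Y y)) z v =
      S z (localCov Γ Y z v) + localDerivEnd Γ S z v (Y z) := by
  rw [localCov_apply, localCov_apply, localDerivEnd, fderiv_clm_apply hS hY, map_add]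
  simp only [add_apply, ContinuousLinearMap.comp_apply, ContinuousLinearMap.flip_apply]
  abel

theorem differentiableAt_localCov_apply {Y : F → F} {Z : F → G} (hΓ : DifferentiableAt ℝ Γ z)
    (hY : DifferentiableAt ℝ Y z) (hZ : ContDiffAt ℝ 2 Z z) :
    DifferentiableAt ℝ (fun y ↦ localCov Γ Z y (Y y)) z :=
  have hZ₂ : DifferentiableAt ℝ (fderiv ℝ Z) z :=
    (hZ.fderiv_right (m := 1) (by norm_num)).differentiableAt (by simp)
  (hZ₂.clm_apply hY).add ((hΓ.clm_apply hY).clm_apply (hZ.differentiableAt (by simp)))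

theorem localCov_localCov_apply {Y : F → F} {Z : F → G} (hΓ : DifferentiableAt ℝ Γ z)
    (hY : DifferentiableAt ℝ Y z) (hZ : ContDiffAt ℝ 2 Z z) (v : F) :
    localCov Γ (fun y ↦ localCov Γ Z y (Y y)) z v =
      localCov Γ Z z (fderiv ℝ Y z v) + fderiv ℝ (fderiv ℝ Z) z v (Y z) +
        Γ z (Y z) (fderiv ℝ Z z v) + Γ z v (fderiv ℝ Z z (Y z)) +
        (fderiv ℝ Γ z v (Y z) (Z z) + Γ z v (Γ z (Y z) (Z z))) := by
  have hZ₁ : DifferentiableAt ℝ Z z := hZ.differentiableAt (by simp)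
  have hZ₂ : DifferentiableAt ℝ (fderiv ℝ Z) z :=
    (hZ.fderiv_right (m := 1) (by norm_num)).differentiableAt (by simp)
  have hsum : HasFDerivAt (fun y ↦ localCov Γ Z y (Y y)) _ z :=
    (hZ₂.hasFDerivAt.clm_apply hY.hasFDerivAt).add
      ((hΓ.hasFDerivAt.clm_apply hY.hasFDerivAt).clm_apply hZ₁.hasFDerivAt)
  rw [localCov_apply, hsum.fderiv, localCov_apply, localCov_apply]
  simp only [add_apply, ContinuousLinearMap.comp_apply, ContinuousLinearMap.flip_apply, map_add]
  abel

theorem localCov_comm {X Y : F → F} {Z : F → G} (hΓ : DifferentiableAt ℝ Γ z)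
    (hX : DifferentiableAt ℝ X z) (hY : DifferentiableAt ℝ Y z) (hZ : ContDiffAt ℝ 2 Z z) :
    localCov Γ (fun y ↦ localCov Γ Z y (Y y)) z (X z) -
        localCov Γ (fun y ↦ localCov Γ Z y (X y)) z (Y z) -
        localCov Γ Z z (VectorField.lieBracket ℝ X Y z) =
      localCurvature Γ z (X z) (Y z) (Z z) := by
  have hsymm : fderiv ℝ (fderiv ℝ Z) z (X z) (Y z) = fderiv ℝ (fderiv ℝ Z) z (Y z) (X z) :=
    hZ.isSymmSndFDerivAt (by simp) (X z) (Y z)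
  rw [localCov_localCov_apply hΓ hY hZ, localCov_localCov_apply hΓ hX hZ, hsymm,
    VectorField.lieBracket, map_sub, localCurvature]
  abel

theorem localCurvature_comm_of_localDerivEnd_eq_zero (hΓ : ContDiffAt ℝ 1 Γ z)
    (hS : ContDiffAt ℝ 2 S z) (hpar : ∀ᶠ y in 𝓝 z, ∀ a c, localDerivEnd Γ S y a c = 0)
    (a b : F) (c : G) :
    localCurvature Γ z a b (S z c) = S z (localCurvature Γ z a b c) := by
  have hΓ₁ : DifferentiableAt ℝ Γ z := hΓ.differentiableAt (by simp)
  have hS₁ : DifferentiableAt ℝ S z := hS.differentiableAt (by simp)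
  have hcov : ∀ Y : F → G, DifferentiableAt ℝ Y z → ∀ v,
      localCov Γ (fun y ↦ S y (Y y)) z v = S z (localCov Γ Y z v) := fun Y hY v ↦ by
    rw [localCov_endField_apply hS₁ hY, hpar.self_of_nhds, add_zero]
  have hcov₂ : ∀ a b, localCov Γ (fun y ↦ localCov Γ (fun y ↦ S y c) y b) z a =
      S z (localCov Γ (fun y ↦ localCov Γ (fun _ ↦ c) y b) z a) := fun a b ↦ by
    have hcongr : (fun y ↦ localCov Γ (fun y ↦ S y c) y b) =ᶠ[𝓝 z]
        fun y ↦ S y (localCov Γ (fun _ ↦ c) y b) := by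
      have hd := (hS.eventually (by simp)).mono fun y hy ↦ hy.differentiableAt (by simp)
      filter_upwards [hpar, hd] with y hy hd
      rw [localCov_endField_apply hd (differentiableAt_const c), hy, add_zero]
    rw [localCov_congr hcongr, hcov _ (differentiableAt_localCov_apply hΓ₁
      (differentiableAt_const b) contDiffAt_const)]
  have hconst (v : F) : DifferentiableAt ℝ (fun _ : F ↦ v) z := differentiableAt_const v
  rw [← localCov_comm hΓ₁ (hconst a) (hconst b) (hS.clm_apply contDiffAt_const),
    ← localCov_comm hΓ₁ (hconst a) (hconst b) (contDiffAt_const (c := c)), hcov₂, hcov₂,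
    hcov _ (differentiableAt_const c), map_sub, map_sub]

end LocalConnection

section ChristoffelSymbols

variable {F : Type*} [NormedAddCommGroup F] [NormedSpace ℝ F]

/-- `Γ` is torsion-free and compatible with the metric `g` at `z`. -/
structure IsChristoffel (g : F → F →L[ℝ] F →L[ℝ] ℝ) (Γ : F → F →L[ℝ] F →L[ℝ] F) (z : F) :
    Prop where
  symm : ∀ a b, Γ z a b = Γ z b a
  compat : ∀ a b c, fderiv ℝ g z a b c = g z (Γ z a b) c + g z b (Γ z a c)

/-- The right-hand side of the Koszul formula for constant vector fields, as a function of the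
derivative of the metric. -/
def koszulForm (D : F →L[ℝ] F →L[ℝ] F →L[ℝ] ℝ) : F →L[ℝ] F →L[ℝ] F →L[ℝ] ℝ :=
  (1 / 2 : ℝ) • (D + D.flip -
    (ContinuousLinearMap.flipₗᵢ ℝ F F ℝ : (F →L[ℝ] F →L[ℝ] ℝ) →L[ℝ] F →L[ℝ] F →L[ℝ] ℝ) ∘L D.flip)

theorem koszulForm_apply (D : F →L[ℝ] F →L[ℝ] F →L[ℝ] ℝ) (a b c : F) :
    koszulForm D a b c = 1 / 2 * (D a b c + D b a c - D c a b) := rfl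

/-- The Christoffel symbols of the metric `g`, obtained from the Koszul formula. -/
def christoffel (g : F → F →L[ℝ] F →L[ℝ] ℝ) (z : F) : F →L[ℝ] F →L[ℝ] F :=
  ContinuousLinearMap.compL ℝ F (F →L[ℝ] ℝ) F (g z).inverse ∘L koszulForm (fderiv ℝ g z)

theorem christoffel_apply (g : F → F →L[ℝ] F →L[ℝ] ℝ) (z a b : F) :
    christoffel g z a b = (g z).inverse (koszulForm (fderiv ℝ g z) a b) := rfl

theorem IsChristoffel.fderiv_metric_apply {g : F → F →L[ℝ] F →L[ℝ] ℝ}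
    {Γ : F → F →L[ℝ] F →L[ℝ] F} {Y Z : F → F} {z : F} (h : IsChristoffel g Γ z)
    (hg : DifferentiableAt ℝ g z) (hY : DifferentiableAt ℝ Y z) (hZ : DifferentiableAt ℝ Z z)
    (v : F) :
    fderiv ℝ (fun y ↦ g y (Y y) (Z y)) z v =
      g z (localCov Γ Y z v) (Z z) + g z (Y z) (localCov Γ Z z v) := by
  rw [fderiv_bilinear_apply hg hY hZ, h.compat, localCov_apply, localCov_apply,
    map_add, map_add, add_apply]
  ring

theorem IsChristoffel.lieBracket_eq {g : F → F →L[ℝ] F →L[ℝ] ℝ} {Γ : F → F →L[ℝ] F →L[ℝ] F}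
    {z : F} (h : IsChristoffel g Γ z) (X Y : F → F) :
    VectorField.lieBracket ℝ X Y z = localCov Γ Y z (X z) - localCov Γ X z (Y z) := by
  rw [VectorField.lieBracket, localCov_apply, localCov_apply, h.symm (X z)]
  abel

theorem IsChristoffel.koszul {g : F → F →L[ℝ] F →L[ℝ] ℝ} {Γ : F → F →L[ℝ] F →L[ℝ] F} {z : F}
    (hs : ∀ a b, g z a b = g z b a) (h : IsChristoffel g Γ z) (a b c : F) :
    2 * g z (Γ z a b) c = fderiv ℝ g z a b c + fderiv ℝ g z b a c - fderiv ℝ g z c a b := by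
  rw [h.compat, h.compat, h.compat, h.symm b a, h.symm c a, h.symm c b, hs (Γ z a c) b]
  ring

theorem IsChristoffel.unique {g : F → F →L[ℝ] F →L[ℝ] ℝ} {Γ Γ' : F → F →L[ℝ] F →L[ℝ] F} {z : F}
    (hs : ∀ a b, g z a b = g z b a) (hn : ∀ a, (∀ b, g z a b = 0) → a = 0)
    (h : IsChristoffel g Γ z) (h' : IsChristoffel g Γ' z) : Γ z = Γ' z := by
  ext a b
  rw [← sub_eq_zero]
  refine hn _ fun c ↦ ?_
  rw [map_sub, sub_apply]
  linarith [h.koszul hs a b c, h'.koszul hs a b c]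

variable [FiniteDimensional ℝ F]

theorem isInvertible_of_nondegenerate {B : F →L[ℝ] F →L[ℝ] ℝ}
    (hn : ∀ a, (∀ b, B a b = 0) → a = 0) : B.IsInvertible := by
  have hinj : Function.Injective (B : F →ₗ[ℝ] F →L[ℝ] ℝ) :=
    (injective_iff_map_eq_zero _).2 fun a ha ↦ hn a fun b ↦ DFunLike.congr_fun ha b
  have hdim : Module.finrank ℝ F = Module.finrank ℝ (F →L[ℝ] ℝ) := by
    rw [← LinearEquiv.finrank_eq (LinearMap.toContinuousLinearMap (𝕜 := ℝ) (E := F) (F' := ℝ))]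
    exact Subspace.dual_finrank_eq.symm
  exact ⟨(LinearEquiv.ofInjectiveOfFinrankEq _ hinj hdim).toContinuousLinearEquiv,
    ContinuousLinearMap.ext fun _ ↦ rfl⟩

theorem isChristoffel_christoffel {g : F → F →L[ℝ] F →L[ℝ] ℝ} {z : F}
    (hd : DifferentiableAt ℝ g z) (hs : ∀ᶠ y in 𝓝 z, ∀ a b, g y a b = g y b a)
    (hn : ∀ a, (∀ b, g z a b = 0) → a = 0) : IsChristoffel g (christoffel g) z := by
  have hsymm := fderiv_bilinear_symm hd hs
  have hkoszul : ∀ a b c, g z (christoffel g z a b) c =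
      1 / 2 * (fderiv ℝ g z a b c + fderiv ℝ g z b a c - fderiv ℝ g z c a b) := by
    intro a b c
    rw [← koszulForm_apply, christoffel_apply,
      (isInvertible_of_nondegenerate hn).self_apply_inverse]
  constructor
  · intro a b
    rw [christoffel_apply, christoffel_apply]
    congr 1
    ext c
    rw [koszulForm_apply, koszulForm_apply, hsymm c a b]
    ring
  · intro a b c
    rw [hs.self_of_nhds b, hkoszul, hkoszul, hsymm a c b]
    ring

theorem contDiffOn_koszulForm {n : WithTop ℕ∞} {D : F → F →L[ℝ] F →L[ℝ] F →L[ℝ] ℝ} {U : Set F}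
    (hD : ContDiffOn ℝ n D U) : ContDiffOn ℝ n (fun z ↦ koszulForm (D z)) U := by
  simp only [contDiffOn_clm_apply, koszulForm_apply]
  intro a b c
  have h (a b c : F) : ContDiffOn ℝ n (fun z ↦ D z a b c) U :=
    ((hD.clm_apply contDiffOn_const).clm_apply contDiffOn_const).clm_apply contDiffOn_const
  exact contDiffOn_const.mul (((h a b c).add (h b a c)).sub (h c a b))

theorem contDiffOn_christoffel {m n : WithTop ℕ∞} {g : F → F →L[ℝ] F →L[ℝ] ℝ} {U : Set F}
    (hU : IsOpen U) (hg : ContDiffOn ℝ n g U) (hmn : m + 1 ≤ n)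
    (hn : ∀ z ∈ U, ∀ a, (∀ b, g z a b = 0) → a = 0) : ContDiffOn ℝ m (christoffel g) U := by
  have hinv : ContDiffOn ℝ m (fun z ↦ (g z).inverse) U := by
    intro z hz
    obtain ⟨e, he⟩ := isInvertible_of_nondegenerate (hn z hz)
    have h := contDiffAt_map_inverse (𝕜 := ℝ) (n := m) e
    rw [he] at h
    exact h.comp_contDiffWithinAt z ((hg z hz).of_le (le_self_add.trans hmn))
  have hkoszul := contDiffOn_koszulForm (hg.fderiv_of_isOpen hU hmn)
  simp only [contDiffOn_clm_apply (f := christoffel g), contDiffOn_clm_apply, christoffel_apply]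
  intro a b
  exact hinv.clm_apply ((hkoszul.clm_apply contDiffOn_const).clm_apply contDiffOn_const)

end ChristoffelSymbols

section ConnectionsInCharts

variable {F : Type*} [NormedAddCommGroup F] [NormedSpace ℝ F]
  {H : Type*} [TopologicalSpace H] {I : ModelWithCorners ℝ F H}
  {N : Type*} [TopologicalSpace N] [ChartedSpace H N] [IsManifold I ∞ N] {x₀ x : N} {z : F}

/-- `Γ` is the connection form of the connection `D` in the chart at `x₀`. -/
def HasChristoffel (D : Connection I N) (x₀ : N) (Γ : F → F →L[ℝ] F →L[ℝ] F) : Prop :=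
  ∀ x ∈ (extChartAt I x₀).source, ∀ Y : ∀ x : N, TangentSpace I x,
    MDifferentiableAt I (I.prod 𝓘(ℝ, F)) (fun y ↦ TotalSpace.mk' F y (Y y)) x →
    ∀ v : TangentSpace I x, chartDeriv I x₀ x (D Y x v) =
      localCov Γ (fieldInChart x₀ Y) (extChartAt I x₀ x) (chartDeriv I x₀ x v)

/-- The connection with connection form `Γ` in the chart at `x₀`; only its values on the chart
domain are meaningful. -/
def chartConnection (x₀ : N) (Γ : F → F →L[ℝ] F →L[ℝ] F) : Connection I N := fun Y x ↦
  chartDerivSymm I x₀ x ∘L localCov Γ (fieldInChart x₀ Y) (extChartAt I x₀ x) ∘L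
    chartDeriv I x₀ x

theorem hasChristoffel_chartConnection (x₀ : N) (Γ : F → F →L[ℝ] F →L[ℝ] F) :
    HasChristoffel (chartConnection (I := I) x₀ Γ) x₀ Γ := fun _ hx _ _ _ ↦
  chartDeriv_chartDerivSymm hx _

variable [I.Boundaryless]

theorem isCovariantDerivativeOn_chartConnection (x₀ : N) (Γ : F → F →L[ℝ] F →L[ℝ] F) :
    IsCovariantDerivativeOn F (chartConnection (I := I) x₀ Γ) (extChartAt I x₀).source where
  add {Y Z x} hY hZ hx := by
    ext v
    have hadd : fieldInChart x₀ (Y + Z) = fun z ↦ fieldInChart x₀ Y z + fieldInChart x₀ Z z :=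
      funext fun _ ↦ map_add _ _ _
    change chartDerivSymm I x₀ x (localCov Γ (fieldInChart x₀ (Y + Z)) _ _) = _
    rw [hadd, localCov_add (differentiableAt_fieldInChart hx hY)
      (differentiableAt_fieldInChart hx hZ), map_add]
    rfl
  leibniz {Y f x} hY hf hx := by
    ext v
    have hsmul : fieldInChart x₀ (f • Y) =
        fun z ↦ f ((extChartAt I x₀).symm z) • fieldInChart x₀ Y z :=
      funext fun _ ↦ map_smul _ _ _
    change chartDerivSymm I x₀ x (localCov Γ (fieldInChart x₀ (f • Y)) (extChartAt I x₀ x)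
      (chartDeriv I x₀ x v)) = _
    rw [hsmul, localCov_smul (differentiableAt_comp_extChartAt_symm hx hf)
      (differentiableAt_fieldInChart hx hY), ← mvfderiv_eq_fderiv_chartDeriv hx hf,
      (extChartAt I x₀).left_inv hx, fieldInChart_extChartAt hx, map_add, map_smul, map_smul,
      chartDerivSymm_chartDeriv hx]
    rfl

theorem fieldInChart_fieldOfChart_eventuallyEq (hz : z ∈ (extChartAt I x₀).target) (W : F → F) :
    fieldInChart x₀ (fieldOfChart I x₀ W) =ᶠ[𝓝 z] W := by
  filter_upwards [extChartAt_target_mem_nhds' hz] with y hy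
  exact fieldInChart_fieldOfChart hy W

theorem HasChristoffel.chartDeriv_fieldOfChart {D : Connection I N} {Γ : F → F →L[ℝ] F →L[ℝ] F}
    (hΓ : HasChristoffel D x₀ Γ) (hx : x ∈ (extChartAt I x₀).source) {W : F → F}
    (hW : DifferentiableAt ℝ W (extChartAt I x₀ x)) (v : TangentSpace I x) :
    chartDeriv I x₀ x (D (fieldOfChart I x₀ W) x v) =
      localCov Γ W (extChartAt I x₀ x) (chartDeriv I x₀ x v) := by
  rw [hΓ x hx _ (mdifferentiableAt_fieldOfChart hx hW), localCov_congr
    (fieldInChart_fieldOfChart_eventuallyEq ((extChartAt I x₀).map_source hx) W)]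

theorem mvfderiv_form {g : FormField I N} (hg : SmoothForm g)
    (hx : x ∈ (extChartAt I x₀).source) {Y Z : ∀ x : N, TangentSpace I x}
    (hY : MDifferentiableAt I (I.prod 𝓘(ℝ, F)) (fun y ↦ TotalSpace.mk' F y (Y y)) x)
    (hZ : MDifferentiableAt I (I.prod 𝓘(ℝ, F)) (fun y ↦ TotalSpace.mk' F y (Z y)) x)
    (v : TangentSpace I x) :
    mvfderiv I (fun y ↦ g y (Y y) (Z y)) x v =
      fderiv ℝ (fun z ↦ formInChart x₀ g z (fieldInChart x₀ Y z) (fieldInChart x₀ Z z))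
        (extChartAt I x₀ x) (chartDeriv I x₀ x v) := by
  have hgYZ : MDifferentiableAt I 𝓘(ℝ, ℝ) (fun y ↦ g y (Y y) (Z y)) x := by
    have h := MDifferentiableAt.clm_bundle_apply₂ (E₃ := fun _ : N ↦ ℝ)
      ((hg x).mdifferentiableAt (by simp)) hY hZ
    exact (mdifferentiableAt_totalSpace (IB := I) _ |>.1 h).2
  have hcongr : (fun z ↦ g ((extChartAt I x₀).symm z) (Y ((extChartAt I x₀).symm z))
      (Z ((extChartAt I x₀).symm z))) =ᶠ[𝓝 (extChartAt I x₀ x)]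
      fun z ↦ formInChart x₀ g z (fieldInChart x₀ Y z) (fieldInChart x₀ Z z) := by
    filter_upwards [extChartAt_target_mem_nhds' ((extChartAt I x₀).map_source hx)] with z hz
    exact (formInChart_fieldInChart hz g Y Z).symm
  rw [mvfderiv_eq_fderiv_chartDeriv hx hgYZ, hcongr.fderiv_eq]

variable [FiniteDimensional ℝ F]

theorem exists_hasChristoffel (cov : CovariantDerivative I F (TangentSpace I : N → Type _))
    (x₀ : N) : ∃ Γ, HasChristoffel cov.toFun x₀ Γ := by
  have hcov : IsCovariantDerivativeOn F cov.toFun (extChartAt I x₀).source :=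
    cov.isCovariantDerivativeOn
  have hchart := isCovariantDerivativeOn_chartConnection (I := I) x₀ 0
  let A : ∀ x : N, TangentSpace I x →L[ℝ] TangentSpace I x →L[ℝ] TangentSpace I x :=
    hcov.difference hchart
  let Γ (z : F) : F →L[ℝ] F →L[ℝ] F :=
    let Az : F →L[ℝ] F →L[ℝ] F := A ((extChartAt I x₀).symm z)
    let S : F →L[ℝ] F := chartDerivSymm I x₀ ((extChartAt I x₀).symm z)
    let T : F →L[ℝ] F := chartDeriv I x₀ ((extChartAt I x₀).symm z)
    (ContinuousLinearMap.compL ℝ F F F T).comp (Az.bilinearComp S S).flip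
  have hΓ : ∀ z a b, Γ z a b = chartDeriv I x₀ ((extChartAt I x₀).symm z)
      (A ((extChartAt I x₀).symm z) (chartDerivSymm I x₀ ((extChartAt I x₀).symm z) b)
        (chartDerivSymm I x₀ ((extChartAt I x₀).symm z) a)) := fun _ _ _ ↦ rfl
  refine ⟨Γ, fun x hx Y hY v ↦ ?_⟩
  have hA : A x (Y x) v = cov.toFun Y x v - chartConnection x₀ 0 Y x v :=
    DFunLike.congr_fun (IsCovariantDerivativeOn.difference_apply hcov hchart hx hY) v
  rw [localCov_apply, fieldInChart_extChartAt hx, hΓ, (extChartAt I x₀).left_inv hx,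
    chartDerivSymm_chartDeriv hx, chartDerivSymm_chartDeriv hx, hA, map_sub,
    hasChristoffel_chartConnection x₀ 0 x hx Y hY, localCov_apply, Pi.zero_apply, zero_apply,
    zero_apply, add_zero, add_sub_cancel]

theorem differentiableAt_formInChart {g : FormField I N} (hg : SmoothForm g)
    (hz : z ∈ (extChartAt I x₀).target) : DifferentiableAt ℝ (formInChart x₀ g) z :=
  ((contDiffOn_formInChart hg x₀).contDiffAt (extChartAt_target_mem_nhds' hz)).differentiableAt
    (by simp)

end ConnectionsInCharts

section LeviCivita

variable {F : Type*} [NormedAddCommGroup F] [NormedSpace ℝ F]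
  {H : Type*} [TopologicalSpace H] {I : ModelWithCorners ℝ F H}
  {N : Type*} [TopologicalSpace N] [ChartedSpace H N] [IsManifold I ∞ N]
  {x₀ x : N} {z : F} {g : FormField I N}

theorem formInChart_symm (hg : IsPseudoRiemannian g) (z a b : F) :
    formInChart x₀ g z a b = formInChart x₀ g z b a := by
  rw [formInChart_apply, formInChart_apply, hg.symm]

theorem formInChart_nondegenerate (hg : IsPseudoRiemannian g)
    (hz : z ∈ (extChartAt I x₀).target) (a : F) (h : ∀ b, formInChart x₀ g z a b = 0) :
    a = 0 := by
  have hx := (extChartAt I x₀).map_target hz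
  have hzero : chartDerivSymm I x₀ ((extChartAt I x₀).symm z) a = 0 := by
    refine hg.nondegenerate _ _ fun w ↦ ?_
    rw [← chartDerivSymm_chartDeriv hx w]
    exact h _
  rw [← chartDeriv_chartDerivSymm (I := I) hx a, hzero, map_zero]

variable [FiniteDimensional ℝ F] [I.Boundaryless]

theorem IsLeviCivita.isChristoffel (hg : SmoothForm g)
    {cov : CovariantDerivative I F (TangentSpace I : N → Type _)} (hcov : IsLeviCivita g cov)
    {Γ : F → F →L[ℝ] F →L[ℝ] F} (hΓ : HasChristoffel cov.toFun x₀ Γ)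
    (hz : z ∈ (extChartAt I x₀).target) : IsChristoffel (formInChart x₀ g) Γ z := by
  have : CompleteSpace F := FiniteDimensional.complete ℝ F
  obtain ⟨x, hx, rfl⟩ : ∃ x ∈ (extChartAt I x₀).source, extChartAt I x₀ x = z :=
    ⟨_, (extChartAt I x₀).map_target hz, (extChartAt I x₀).right_inv hz⟩
  let e (a : F) : ∀ x : N, TangentSpace I x := fieldOfChart I x₀ fun _ ↦ a
  have he (a : F) : MDifferentiableAt I (I.prod 𝓘(ℝ, F)) (fun y ↦ TotalSpace.mk' F y (e a y)) x :=
    mdifferentiableAt_fieldOfChart hx (differentiableAt_const a)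
  have hec (a : F) : fieldInChart x₀ (e a) =ᶠ[𝓝 (extChartAt I x₀ x)] fun _ ↦ a :=
    fieldInChart_fieldOfChart_eventuallyEq hz _
  have hex (a : F) : chartDeriv I x₀ x (e a x) = a := chartDeriv_chartDerivSymm hx a
  have hD (a b : F) : chartDeriv I x₀ x (cov.toFun (e b) x (e a x)) =
      Γ (extChartAt I x₀ x) a b := by
    rw [hΓ.chartDeriv_fieldOfChart hx (differentiableAt_const b), localCov_const, hex]
  constructor
  · intro a b
    have htorsion := (CovariantDerivative.torsion_eq_zero_iff cov).1 hcov.torsion_free (he a) (he b)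
    have hbracket : chartDeriv I x₀ x (VectorField.mlieBracket I (e a) (e b) x) = 0 := by
      rw [chartDeriv_mlieBracket hx (he a) (he b),
        (hec a).lieBracket_vectorField_eq (hec b), VectorField.lieBracket]
      simp
    rw [← htorsion, map_sub, sub_eq_zero] at hbracket
    rw [← hD, ← hD]
    exact hbracket
  · intro a b c
    have hmetric := hcov.metric x _ _ (he b) (he c) (e a x)
    have hcongr : (fun z ↦ formInChart x₀ g z (fieldInChart x₀ (e b) z) (fieldInChart x₀ (e c) z))
        =ᶠ[𝓝 (extChartAt I x₀ x)] fun z ↦ formInChart x₀ g z b c := by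
      filter_upwards [hec b, hec c] with z hb hc
      rw [hb, hc]
    have hd := differentiableAt_formInChart hg hz
    rw [mvfderiv_form hg hx (he b) (he c), hcongr.fderiv_eq,
      fderiv_clm_apply_const (hd.clm_apply (differentiableAt_const b)),
      fderiv_clm_apply_const hd, ← formInChart_extChartAt_chartDeriv hx g (cov _ _ _),
      ← formInChart_extChartAt_chartDeriv hx g (e b x), hex, hex, hex] at hmetric
    rw [hmetric, ← hD a b, ← hD a c]

theorem isChristoffel_formInChart (hg : IsPseudoRiemannian g)
    (hz : z ∈ (extChartAt I x₀).target) :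
    IsChristoffel (formInChart x₀ g) (christoffel (formInChart x₀ g)) z :=
  isChristoffel_christoffel (differentiableAt_formInChart hg.smooth hz)
    (Filter.Eventually.of_forall fun _ ↦ formInChart_symm hg _) (formInChart_nondegenerate hg hz)

theorem contDiffOn_christoffel_formInChart (hg : IsPseudoRiemannian g) (x₀ : N) :
    ContDiffOn ℝ ∞ (christoffel (formInChart x₀ g)) (extChartAt I x₀).target :=
  contDiffOn_christoffel (isOpen_extChartAt_target x₀) (contDiffOn_formInChart hg.smooth x₀)
    (by simp) fun _ hz ↦ formInChart_nondegenerate hg hz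

theorem exists_isLeviCivita (hg : IsPseudoRiemannian g) :
    ∃ cov : CovariantDerivative I F (TangentSpace I : N → Type _), IsLeviCivita g cov := by
  have : CompleteSpace F := FiniteDimensional.complete ℝ F
  let Γ (x : N) := christoffel (formInChart x g)
  have hs (x : N) := mem_extChartAt_source (I := I) x
  have ht (x : N) := mem_extChartAt_target (I := I) x
  have hC (x : N) := isChristoffel_formInChart hg (ht x)
  let cov : CovariantDerivative I F (TangentSpace I : N → Type _) :=
    { toFun := fun Y x ↦ chartConnection x (Γ x) Y x
      isCovariantDerivativeOnUniv :=
        { add := fun {_ _ x} hY hZ _ ↦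
            (isCovariantDerivativeOn_chartConnection x (Γ x)).add hY hZ (hs x)
          leibniz := fun {_ _ x} hY hf _ ↦
            (isCovariantDerivativeOn_chartConnection x (Γ x)).leibniz hY hf (hs x) } }
  have hcov (x : N) (Y : ∀ x : N, TangentSpace I x) (v : TangentSpace I x) :
      chartDeriv I x x (cov Y x v) =
        localCov (Γ x) (fieldInChart x Y) (extChartAt I x x) (chartDeriv I x x v) :=
    chartDeriv_chartDerivSymm (hs x) _
  refine ⟨cov, ⟨(CovariantDerivative.torsion_eq_zero_iff cov).2 fun {X Y x} hX hY ↦ ?_,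
    fun x Y Z hY hZ v ↦ ?_⟩⟩
  · refine chartDeriv_injective (hs x) ?_
    rw [chartDeriv_mlieBracket (hs x) hX hY, (hC x).lieBracket_eq, map_sub, hcov, hcov,
      fieldInChart_extChartAt (hs x), fieldInChart_extChartAt (hs x)]
  · rw [mvfderiv_form hg.smooth (hs x) hY hZ, (hC x).fderiv_metric_apply
      (differentiableAt_formInChart hg.smooth (ht x)) (differentiableAt_fieldInChart (hs x) hY)
      (differentiableAt_fieldInChart (hs x) hZ), ← hcov, ← hcov, fieldInChart_extChartAt (hs x),
      fieldInChart_extChartAt (hs x), formInChart_extChartAt_chartDeriv (hs x),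
      formInChart_extChartAt_chartDeriv (hs x)]

theorem leviCivita_spec (hg : IsPseudoRiemannian g) :
    ∃ cov : CovariantDerivative I F (TangentSpace I : N → Type _),
      IsLeviCivita g cov ∧ leviCivita g = cov.toFun := by
  have h := exists_isLeviCivita hg
  exact ⟨h.choose, h.choose_spec, dif_pos h⟩

theorem hasChristoffel_leviCivita (hg : IsPseudoRiemannian g) {Γ : F → F →L[ℝ] F →L[ℝ] F}
    (hΓ : ∀ z ∈ (extChartAt I x₀).target, IsChristoffel (formInChart x₀ g) Γ z) :
    HasChristoffel (leviCivita g) x₀ Γ := by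
  obtain ⟨cov, hcov, h⟩ := leviCivita_spec hg
  obtain ⟨Γ', hΓ'⟩ := exists_hasChristoffel cov x₀
  rw [h]
  intro x hx Y hY v
  have hz := (extChartAt I x₀).map_source hx
  rw [hΓ' x hx Y hY v, localCov, localCov, (hΓ _ hz).unique (formInChart_symm hg _)
    (formInChart_nondegenerate hg hz) (hcov.isChristoffel hg.smooth hΓ' hz)]

end LeviCivita

section ParallelAndFlat

variable {F : Type*} [NormedAddCommGroup F] [NormedSpace ℝ F]
  {H : Type*} [TopologicalSpace H] {I : ModelWithCorners ℝ F H}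
  {N : Type*} [TopologicalSpace N] [ChartedSpace H N] [IsManifold I ∞ N]
  {x₀ x : N} {z : F} {D : Connection I N} {Γ : F → F →L[ℝ] F →L[ℝ] F} {J : EndField I N}

theorem mdifferentiableAt_endField (hJ : SmoothEnd J) {Y : ∀ x : N, TangentSpace I x}
    (hY : MDifferentiableAt I (I.prod 𝓘(ℝ, F)) (fun y ↦ TotalSpace.mk' F y (Y y)) x) :
    MDifferentiableAt I (I.prod 𝓘(ℝ, F)) (fun y ↦ TotalSpace.mk' F y (J y (Y y))) x :=
  MDifferentiableAt.clm_bundle_apply ((hJ x).mdifferentiableAt (by simp)) hY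

variable [I.Boundaryless]

theorem HasChristoffel.localCov_fieldInChart_eventuallyEq (hD : HasChristoffel D x₀ Γ)
    (hx : x ∈ (extChartAt I x₀).source) {Z : ∀ x : N, TangentSpace I x}
    (hZ : ContMDiffAt I (I.prod 𝓘(ℝ, F)) ∞ (fun y ↦ TotalSpace.mk' F y (Z y)) x)
    (Y : ∀ x : N, TangentSpace I x) :
    (fun z ↦ localCov Γ (fieldInChart x₀ Z) z (fieldInChart x₀ Y z)) =ᶠ[𝓝 (extChartAt I x₀ x)]
      fieldInChart x₀ fun y ↦ D Z y (Y y) := by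
  have hnear : ∀ᶠ y in 𝓝 x,
      MDifferentiableAt I (I.prod 𝓘(ℝ, F)) (fun y ↦ TotalSpace.mk' F y (Z y)) y :=
    ((contMDiffAt_iff_contMDiffAt_nhds (by simp)).1
      (hZ.of_le (m := 1) ENat.LEInfty.out)).mono fun _ hy ↦ hy.mdifferentiableAt (by simp)
  have hsymm := continuousAt_extChartAt_symm' hx
  rw [ContinuousAt, (extChartAt I x₀).left_inv hx] at hsymm
  filter_upwards [hsymm.eventually hnear,
    extChartAt_target_mem_nhds' ((extChartAt I x₀).map_source hx)] with z hZz hz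
  have h := hD _ ((extChartAt I x₀).map_target hz) Z hZz (Y ((extChartAt I x₀).symm z))
  rw [(extChartAt I x₀).right_inv hz] at h
  exact h.symm

theorem chartDeriv_curvature [CompleteSpace F] (hD : HasChristoffel D x₀ Γ)
    (hΓ : ContDiffOn ℝ ∞ Γ (extChartAt I x₀).target)
    (hx : x ∈ (extChartAt I x₀).source) {X Y Z : ∀ x : N, TangentSpace I x}
    (hX : ContMDiffAt I (I.prod 𝓘(ℝ, F)) ∞ (fun y ↦ TotalSpace.mk' F y (X y)) x)
    (hY : ContMDiffAt I (I.prod 𝓘(ℝ, F)) ∞ (fun y ↦ TotalSpace.mk' F y (Y y)) x)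
    (hZ : ContMDiffAt I (I.prod 𝓘(ℝ, F)) ∞ (fun y ↦ TotalSpace.mk' F y (Z y)) x) :
    chartDeriv I x₀ x (curvature D X Y Z x) = localCurvature Γ (extChartAt I x₀ x)
      (chartDeriv I x₀ x (X x)) (chartDeriv I x₀ x (Y x)) (chartDeriv I x₀ x (Z x)) := by
  have hΓd : DifferentiableAt ℝ Γ (extChartAt I x₀ x) := (hΓ.contDiffAt
    (extChartAt_target_mem_nhds' ((extChartAt I x₀).map_source hx))).differentiableAt (by simp)
  have hXd := hX.mdifferentiableAt (by simp)
  have hYd := hY.mdifferentiableAt (by simp)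
  have hZc : ContDiffAt ℝ 2 (fieldInChart x₀ Z) (extChartAt I x₀ x) :=
    (contDiffAt_fieldInChart (n := ⊤) hx hZ).of_le ENat.LEInfty.out
  have hcov {Y : ∀ x : N, TangentSpace I x}
      (hY : MDifferentiableAt I (I.prod 𝓘(ℝ, F)) (fun y ↦ TotalSpace.mk' F y (Y y)) x)
      (v : TangentSpace I x) :
      chartDeriv I x₀ x (D (fun y ↦ D Z y (Y y)) x v) =
        localCov Γ (fun z ↦ localCov Γ (fieldInChart x₀ Z) z (fieldInChart x₀ Y z))
          (extChartAt I x₀ x) (chartDeriv I x₀ x v) := by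
    have hcongr := hD.localCov_fieldInChart_eventuallyEq hx hZ Y
    have hDZY := mdifferentiableAt_of_fieldInChart hx <|
      (differentiableAt_localCov_apply hΓd (differentiableAt_fieldInChart hx hY)
        hZc).congr_of_eventuallyEq hcongr.symm
    rw [hD x hx _ hDZY, localCov_congr hcongr]
  have hcomm := localCov_comm hΓd (differentiableAt_fieldInChart hx hXd)
    (differentiableAt_fieldInChart hx hYd) hZc
  simp only [fieldInChart_extChartAt hx] at hcomm
  rw [curvature, map_sub, map_sub, hcov hYd, hcov hXd, hD x hx Z (hZ.mdifferentiableAt (by simp)),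
    chartDeriv_mlieBracket hx hXd hYd, hcomm]

variable [FiniteDimensional ℝ F]

theorem chartDeriv_derivEnd (hD : HasChristoffel D x₀ Γ) (hJ : SmoothEnd J)
    (hx : x ∈ (extChartAt I x₀).source) {Y : ∀ x : N, TangentSpace I x}
    (hY : MDifferentiableAt I (I.prod 𝓘(ℝ, F)) (fun y ↦ TotalSpace.mk' F y (Y y)) x)
    (v : TangentSpace I x) :
    chartDeriv I x₀ x (derivEnd D J x v Y) =
      localDerivEnd Γ (endInChart x₀ J) (extChartAt I x₀ x) (chartDeriv I x₀ x v)
        (chartDeriv I x₀ x (Y x)) := by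
  have hmem := extChartAt_target_mem_nhds' (I := I) ((extChartAt I x₀).map_source hx)
  have hcongr : fieldInChart x₀ (fun y ↦ J y (Y y)) =ᶠ[𝓝 (extChartAt I x₀ x)]
      fun z ↦ endInChart x₀ J z (fieldInChart x₀ Y z) := by
    filter_upwards [hmem] with z hz
    exact fieldInChart_endField_apply hz J Y
  have hJd : DifferentiableAt ℝ (endInChart x₀ J) (extChartAt I x₀ x) :=
    ((contDiffOn_endInChart hJ x₀).contDiffAt hmem).differentiableAt (by simp)
  rw [derivEnd, map_sub, hD x hx _ (mdifferentiableAt_endField hJ hY), localCov_congr hcongr,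
    localCov_endField_apply hJd (differentiableAt_fieldInChart hx hY), ← hD x hx Y hY,
    endInChart_extChartAt_chartDeriv hx, fieldInChart_extChartAt hx, add_sub_cancel_left]

theorem IsParallel.localDerivEnd_eq_zero (hD : HasChristoffel D x₀ Γ) (hJ : SmoothEnd J)
    (h : IsParallel D J) (hz : z ∈ (extChartAt I x₀).target) (a b : F) :
    localDerivEnd Γ (endInChart x₀ J) z a b = 0 := by
  obtain ⟨x, hx, rfl⟩ : ∃ x ∈ (extChartAt I x₀).source, extChartAt I x₀ x = z :=
    ⟨_, (extChartAt I x₀).map_target hz, (extChartAt I x₀).right_inv hz⟩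
  have he := mdifferentiableAt_fieldOfChart (I := I) hx (differentiableAt_const (c := b) (𝕜 := ℝ))
  have hJe := chartDeriv_derivEnd hD hJ hx he (chartDerivSymm I x₀ x a)
  rw [h _ _ _ he, map_zero, fieldOfChart, chartDeriv_chartDerivSymm hx,
    chartDeriv_chartDerivSymm hx] at hJe
  exact hJe.symm

theorem isParallel_of_localDerivEnd_eq_zero (hJ : SmoothEnd J)
    (h : ∀ x₀ : N, ∃ Γ, HasChristoffel D x₀ Γ ∧
      ∀ a b, localDerivEnd Γ (endInChart x₀ J) (extChartAt I x₀ x₀) a b = 0) :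
    IsParallel D J := by
  intro x v Y hY
  obtain ⟨Γ, hD, hzero⟩ := h x
  refine chartDeriv_injective (mem_extChartAt_source x) ?_
  rw [chartDeriv_derivEnd hD hJ (mem_extChartAt_source x) hY, hzero, map_zero]

theorem IsFlat.localCurvature_eq_zero (hD : HasChristoffel D x₀ Γ)
    (hΓ : ContDiffOn ℝ ∞ Γ (extChartAt I x₀).target) (h : IsFlat D)
    (hz : z ∈ (extChartAt I x₀).target) (a b c : F) : localCurvature Γ z a b c = 0 := by
  have : CompleteSpace F := FiniteDimensional.complete ℝ F
  obtain ⟨x, hx, rfl⟩ : ∃ x ∈ (extChartAt I x₀).source, extChartAt I x₀ x = z :=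
    ⟨_, (extChartAt I x₀).map_target hz, (extChartAt I x₀).right_inv hz⟩
  have he (a : F) :=
    contMDiffAt_fieldOfChart (I := I) (n := ⊤) hx (contDiffAt_const (c := a) (𝕜 := ℝ))
  have hR := chartDeriv_curvature hD hΓ hx (he a) (he b) (he c)
  rw [h x _ _ _ (he a) (he b) (he c), map_zero] at hR
  simp only [fieldOfChart, chartDeriv_chartDerivSymm hx] at hR
  exact hR.symm

theorem isFlat_of_localCurvature_eq_zero
    (h : ∀ x₀ : N, ∃ Γ, HasChristoffel D x₀ Γ ∧ ContDiffOn ℝ ∞ Γ (extChartAt I x₀).target ∧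
      ∀ a b c, localCurvature Γ (extChartAt I x₀ x₀) a b c = 0) :
    IsFlat D := by
  have : CompleteSpace F := FiniteDimensional.complete ℝ F
  intro x X Y Z hX hY hZ
  obtain ⟨Γ, hD, hΓ, hzero⟩ := h x
  refine chartDeriv_injective (mem_extChartAt_source x) ?_
  rw [chartDeriv_curvature hD hΓ (mem_extChartAt_source x) hX hY hZ, hzero, map_zero]

theorem isComplex_of_isParallel {g : FormField I N} (hg : IsPseudoRiemannian g)
    (hJ : IsAlmostComplex J) (h : IsParallel (leviCivita g) J) : IsComplex J := by
  have : CompleteSpace F := FiniteDimensional.complete ℝ F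
  refine ⟨hJ, fun x X Y hX hY ↦ ?_⟩
  obtain ⟨cov, hcov, hcov'⟩ := leviCivita_spec hg
  rw [hcov'] at h
  have htorsion {X Y : ∀ x : N, TangentSpace I x} :=
    (CovariantDerivative.torsion_eq_zero_iff cov).1 hcov.torsion_free (X := X) (Y := Y) (x := x)
  have hcomm (v : TangentSpace I x) {Y : ∀ x : N, TangentSpace I x}
      (hY : MDifferentiableAt I (I.prod 𝓘(ℝ, F)) (fun y ↦ TotalSpace.mk' F y (Y y)) x) :
      cov.toFun (fun y ↦ J y (Y y)) x v = J x (cov.toFun Y x v) := sub_eq_zero.1 (h x v Y hY)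
  have hJX := mdifferentiableAt_endField hJ.smooth hX
  have hJY := mdifferentiableAt_endField hJ.smooth hY
  rw [nijenhuis, ← htorsion hX hY, ← htorsion hJX hY, ← htorsion hX hJY, ← htorsion hJX hJY]
  simp only [hcomm _ hX, hcomm _ hY, map_sub, hJ.sq]
  abel

end ParallelAndFlat

section GaugeTransformation

variable {F G G' : Type*} [NormedAddCommGroup F] [NormedSpace ℝ F]
  [NormedAddCommGroup G] [NormedSpace ℝ G] [NormedAddCommGroup G'] [NormedSpace ℝ G']

theorem localDerivEnd_gauge {Γ : F → F →L[ℝ] G →L[ℝ] G} {θ : F → F →L[ℝ] G' →L[ℝ] G'}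
    {P : F → G →L[ℝ] G'} {K : F → G →L[ℝ] G} {S : F → G' →L[ℝ] G'} {z : F}
    (hP : DifferentiableAt ℝ P z) (hK : DifferentiableAt ℝ K z) (hS : DifferentiableAt ℝ S z)
    (hθ : ∀ v c, P z (Γ z v c) - fderiv ℝ P z v c = θ z v (P z c))
    (hKS : ∀ᶠ y in 𝓝 z, ∀ c, P y (K y c) = S y (P y c)) (v : F) (c : G) :
    P z (localDerivEnd Γ K z v c) = localDerivEnd θ S z v (P z c) := by
  have hleft := hP.hasFDerivAt.clm_apply (hK.hasFDerivAt.clm_apply (hasFDerivAt_const c z))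
  have hright := hS.hasFDerivAt.clm_apply (hP.hasFDerivAt.clm_apply (hasFDerivAt_const c z))
  have hKS' : (fun y ↦ P y (K y c)) =ᶠ[𝓝 z] fun y ↦ S y (P y c) := hKS.mono fun y hy ↦ hy c
  have hderiv := DFunLike.congr_fun (hleft.unique (hright.congr_of_eventuallyEq hKS')) v
  simp only [add_apply, ContinuousLinearMap.comp_apply, ContinuousLinearMap.flip_apply,
    zero_apply, map_zero, zero_add] at hderiv
  rw [localDerivEnd, localDerivEnd, map_sub, map_add, eq_sub_of_add_eq hderiv,
    hKS.self_of_nhds (Γ z v c), ← hKS.self_of_nhds c, ← hθ, ← hθ, map_sub]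
  abel

end GaugeTransformation

section LiftInChart

variable {E : Type*} [NormedAddCommGroup E] [NormedSpace ℝ E]

open ContinuousLinearMap (fst snd inl inr precomp postcomp)

/-- The expression `(a, b) ↦ (a, b + Γ(a, w))` in a chart of the horizontal and vertical parts at
the point `p = (z, w)` of the tangent bundle. -/
def partsInChart (Γ : E → E →L[ℝ] E →L[ℝ] E) (p : E × E) : (E × E) ≃L[ℝ] E × E :=
  (ContinuousLinearEquiv.refl ℝ E).skewProd (ContinuousLinearEquiv.refl ℝ E) ((Γ p.1).flip p.2)

theorem partsInChart_apply (Γ : E → E →L[ℝ] E →L[ℝ] E) (p V : E × E) :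
    partsInChart Γ p V = (V.1, V.2 + Γ p.1 V.1 p.2) := rfl

/-- The expression in a chart of the complete lift of the metric `g`. -/
def liftMetric (g : E → E →L[ℝ] E →L[ℝ] ℝ) (p : E × E) : E × E →L[ℝ] E × E →L[ℝ] ℝ :=
  precomp ℝ (fst ℝ E E) ∘L fderiv ℝ g p.1 p.2 ∘L fst ℝ E E +
    precomp ℝ (snd ℝ E E) ∘L g p.1 ∘L fst ℝ E E + precomp ℝ (fst ℝ E E) ∘L g p.1 ∘L snd ℝ E E

theorem liftMetric_apply (g : E → E →L[ℝ] E →L[ℝ] ℝ) (p V W : E × E) :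
    liftMetric g p V W = fderiv ℝ g p.1 p.2 V.1 W.1 + g p.1 V.1 W.2 + g p.1 V.2 W.1 := rfl

/-- The Christoffel symbols of the complete lift of a metric with Christoffel symbols `Γ`. -/
def liftChristoffel (Γ : E → E →L[ℝ] E →L[ℝ] E) (p : E × E) : E × E →L[ℝ] E × E →L[ℝ] E × E :=
  postcomp (E × E) (inl ℝ E E) ∘L precomp E (fst ℝ E E) ∘L Γ p.1 ∘L fst ℝ E E +
    postcomp (E × E) (inr ℝ E E) ∘L
      (precomp E (fst ℝ E E) ∘L fderiv ℝ Γ p.1 p.2 ∘L fst ℝ E E +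
        precomp E (fst ℝ E E) ∘L Γ p.1 ∘L snd ℝ E E + precomp E (snd ℝ E E) ∘L Γ p.1 ∘L fst ℝ E E)

theorem liftChristoffel_apply (Γ : E → E →L[ℝ] E →L[ℝ] E) (p V W : E × E) :
    liftChristoffel Γ p V W = (Γ p.1 V.1 W.1,
      fderiv ℝ Γ p.1 p.2 V.1 W.1 + Γ p.1 V.2 W.1 + Γ p.1 V.1 W.2) := by
  simp [liftChristoffel]

/-- The connection form `(a, b) ↦ (Γ(c, a), Γ(c, b) + R(w, c) a)`, in the direction `(c, d)`, of
the complete lift with respect to horizontal and vertical parts. -/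
def partsConnection (Γ : E → E →L[ℝ] E →L[ℝ] E) (p : E × E) : E × E →L[ℝ] E × E →L[ℝ] E × E :=
  postcomp (E × E) (inl ℝ E E) ∘L precomp E (fst ℝ E E) ∘L Γ p.1 ∘L fst ℝ E E +
    postcomp (E × E) (inr ℝ E E) ∘L
      (precomp E (snd ℝ E E) ∘L Γ p.1 ∘L fst ℝ E E + precomp E (fst ℝ E E) ∘L
        (fderiv ℝ Γ p.1 p.2 - (fderiv ℝ Γ p.1).flip p.2 + postcomp E (Γ p.1 p.2) ∘L Γ p.1 -
          precomp E (Γ p.1 p.2) ∘L Γ p.1) ∘L fst ℝ E E)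

theorem partsConnection_apply (Γ : E → E →L[ℝ] E →L[ℝ] E) (p V W : E × E) :
    partsConnection Γ p V W =
      (Γ p.1 V.1 W.1, Γ p.1 V.1 W.2 + localCurvature Γ p.1 p.2 V.1 W.1) := by
  simp [partsConnection, localCurvature]

variable {g : E → E →L[ℝ] E →L[ℝ] ℝ} {Γ : E → E →L[ℝ] E →L[ℝ] E} {J : E → E →L[ℝ] E}
  {S : E × E → E × E →L[ℝ] E × E} {p : E × E}

theorem contDiffAt_liftMetric {m n : WithTop ℕ∞} (hg : ContDiffAt ℝ n g p.1) (hmn : m + 1 ≤ n) :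
    ContDiffAt ℝ m (liftMetric g) p := by
  have hg' : ContDiffAt ℝ m (fun q : E × E ↦ g q.1) p :=
    (hg.of_le (le_self_add.trans hmn)).comp p contDiffAt_fst
  have hDg : ContDiffAt ℝ m (fun q : E × E ↦ fderiv ℝ g q.1 q.2) p :=
    ((hg.fderiv_right hmn).comp p contDiffAt_fst).clm_apply contDiffAt_snd
  exact ((contDiffAt_const.clm_comp (hDg.clm_comp contDiffAt_const)).add
    (contDiffAt_const.clm_comp (hg'.clm_comp contDiffAt_const))).add
    (contDiffAt_const.clm_comp (hg'.clm_comp contDiffAt_const))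

theorem contDiffAt_flip_apply {n : WithTop ℕ∞} (hΓ : ContDiffAt ℝ n Γ p.1) :
    ContDiffAt ℝ n (fun q : E × E ↦ (Γ q.1).flip q.2) p :=
  ((ContinuousLinearMap.flipₗᵢ ℝ E E E).contDiff.contDiffAt.comp p
    (hΓ.comp p contDiffAt_fst)).clm_apply contDiffAt_snd

theorem contDiffAt_partsInChart {n : WithTop ℕ∞} (hΓ : ContDiffAt ℝ n Γ p.1) :
    ContDiffAt ℝ n (fun q ↦ (partsInChart Γ q : E × E →L[ℝ] E × E)) p := by
  have hcoe (q : E × E) : (partsInChart Γ q : E × E →L[ℝ] E × E) =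
      ContinuousLinearMap.id ℝ (E × E) + inr ℝ E E ∘L (Γ q.1).flip q.2 ∘L fst ℝ E E := by
    ext V <;> simp [partsInChart_apply]
  simp only [hcoe]
  exact contDiffAt_const.add (contDiffAt_const.clm_comp
    ((contDiffAt_flip_apply hΓ).clm_comp contDiffAt_const))

theorem contDiffAt_partsInChart_symm {n : WithTop ℕ∞} (hΓ : ContDiffAt ℝ n Γ p.1) :
    ContDiffAt ℝ n (fun q ↦ ((partsInChart Γ q).symm : E × E →L[ℝ] E × E)) p := by
  have hcoe (q : E × E) : ((partsInChart Γ q).symm : E × E →L[ℝ] E × E) =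
      ContinuousLinearMap.id ℝ (E × E) - inr ℝ E E ∘L (Γ q.1).flip q.2 ∘L fst ℝ E E := by
    ext V <;> simp [partsInChart]
  simp only [hcoe]
  exact contDiffAt_const.sub (contDiffAt_const.clm_comp
    ((contDiffAt_flip_apply hΓ).clm_comp contDiffAt_const))

theorem fderiv_liftMetric_apply (hg : ContDiffAt ℝ 2 g p.1) (V W Z : E × E) :
    fderiv ℝ (liftMetric g) p V W Z = fderiv ℝ (fderiv ℝ g) p.1 V.1 p.2 W.1 Z.1 +
      fderiv ℝ g p.1 V.2 W.1 Z.1 + fderiv ℝ g p.1 V.1 W.1 Z.2 + fderiv ℝ g p.1 V.1 W.2 Z.1 := by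
  have hlift : DifferentiableAt ℝ (liftMetric g) p :=
    (contDiffAt_liftMetric (m := 1) hg (by norm_num)).differentiableAt (by simp)
  have hg₁ := (hg.differentiableAt (by simp)).hasFDerivAt.comp p hasFDerivAt_fst
  have hg₂ := ((hg.fderiv_right (m := 1) (by norm_num)).differentiableAt
    (by simp)).hasFDerivAt.comp p hasFDerivAt_fst
  have hconst (X : E) := hasFDerivAt_const X p (𝕜 := ℝ)
  have hsum := ((((hg₂.clm_apply hasFDerivAt_snd).clm_apply (hconst W.1)).clm_apply
    (hconst Z.1)).add ((hg₁.clm_apply (hconst W.1)).clm_apply (hconst Z.2))).add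
    ((hg₁.clm_apply (hconst W.2)).clm_apply (hconst Z.1))
  rw [← fderiv_clm_apply_const hlift,
    ← fderiv_clm_apply_const (hlift.clm_apply (differentiableAt_const W))]
  refine (DFunLike.congr_fun hsum.fderiv V).trans ?_
  simp
  ring

theorem fderiv_fderiv_of_isChristoffel {z : E} (hg : ContDiffAt ℝ 2 g z)
    (hΓ : DifferentiableAt ℝ Γ z) (h : ∀ᶠ y in 𝓝 z, IsChristoffel g Γ y) (v a b c : E) :
    fderiv ℝ (fderiv ℝ g) z v a b c =
      fderiv ℝ g z v (Γ z a b) c + g z (fderiv ℝ Γ z v a b) c +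
        (fderiv ℝ g z v b (Γ z a c) + g z b (fderiv ℝ Γ z v a c)) := by
  have hg₁ : DifferentiableAt ℝ g z := hg.differentiableAt (by simp)
  have hg₂ : DifferentiableAt ℝ (fderiv ℝ g) z :=
    (hg.fderiv_right (m := 1) (by norm_num)).differentiableAt (by simp)
  have hga : DifferentiableAt ℝ (fun y ↦ fderiv ℝ g y a) z :=
    hg₂.clm_apply (differentiableAt_const a)
  have hΓab (b : E) : DifferentiableAt ℝ (fun y ↦ Γ y a b) z :=
    (hΓ.clm_apply (differentiableAt_const a)).clm_apply (differentiableAt_const b)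
  have hfderivΓ (b : E) : fderiv ℝ (fun y ↦ Γ y a b) z v = fderiv ℝ Γ z v a b := by
    rw [fderiv_clm_apply_const (hΓ.clm_apply (differentiableAt_const a)),
      fderiv_clm_apply_const hΓ]
  have hcompat : (fun y ↦ fderiv ℝ g y a b c) =ᶠ[𝓝 z]
      fun y ↦ g y (Γ y a b) c + g y b (Γ y a c) := h.mono fun y hy ↦ hy.compat a b c
  have hconst (c : E) : DifferentiableAt ℝ (fun _ : E ↦ c) z := differentiableAt_const c
  rw [← fderiv_clm_apply_const hg₂, ← fderiv_clm_apply_const hga,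
    ← fderiv_clm_apply_const (hga.clm_apply (hconst b)), hcompat.fderiv_eq,
    fderiv_fun_add ((hg₁.clm_apply (hΓab b)).clm_apply (hconst c))
      ((hg₁.clm_apply (hconst b)).clm_apply (hΓab c)), add_apply,
    fderiv_bilinear_apply hg₁ (hΓab b) (hconst c), fderiv_bilinear_apply hg₁ (hconst b) (hΓab c),
    hfderivΓ, hfderivΓ]
  simp

theorem isChristoffel_liftChristoffel (hg : ContDiffAt ℝ 2 g p.1) (hΓ : DifferentiableAt ℝ Γ p.1)
    (h : ∀ᶠ z in 𝓝 p.1, IsChristoffel g Γ z) :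
    IsChristoffel (liftMetric g) (liftChristoffel Γ) p := by
  have hp := h.self_of_nhds
  constructor
  · intro V W
    rw [liftChristoffel_apply, liftChristoffel_apply, hp.symm W.1,
      fderiv_bilinear_symm hΓ (h.mono fun _ hz ↦ hz.symm) _ W.1, hp.symm V.1 W.2, hp.symm V.2 W.1]
    congr 1
    abel
  · intro V W Z
    have hsymm : fderiv ℝ (fderiv ℝ g) p.1 V.1 p.2 = fderiv ℝ (fderiv ℝ g) p.1 p.2 V.1 :=
      hg.isSymmSndFDerivAt (by simp) _ _
    rw [fderiv_liftMetric_apply hg, hsymm, fderiv_fderiv_of_isChristoffel hg hΓ h]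
    simp only [liftMetric_apply, liftChristoffel_apply, hp.compat, map_add, add_apply]
    ring

theorem fderiv_partsInChart_apply (hΓ : ContDiffAt ℝ 1 Γ p.1) (V W : E × E) :
    fderiv ℝ (fun q ↦ (partsInChart Γ q : E × E →L[ℝ] E × E)) p V W =
      (0, fderiv ℝ Γ p.1 V.1 W.1 p.2 + Γ p.1 W.1 V.2) := by
  have hΓ₁ := (hΓ.differentiableAt (by simp)).hasFDerivAt.comp p hasFDerivAt_fst
  have hprod := (hasFDerivAt_const W.1 p).prodMk ((hasFDerivAt_const W.2 p).add
    ((hΓ₁.clm_apply (hasFDerivAt_const W.1 p)).clm_apply hasFDerivAt_snd))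
  rw [← fderiv_clm_apply_const ((contDiffAt_partsInChart hΓ).differentiableAt (by simp))]
  refine (DFunLike.congr_fun hprod.fderiv V).trans ?_
  simp [add_comm]

theorem partsInChart_liftChristoffel (hΓ : ContDiffAt ℝ 1 Γ p.1)
    (hs : ∀ᶠ z in 𝓝 p.1, ∀ a b, Γ z a b = Γ z b a) (V W : E × E) :
    partsInChart Γ p (liftChristoffel Γ p V W) -
        fderiv ℝ (fun q ↦ (partsInChart Γ q : E × E →L[ℝ] E × E)) p V W =
      partsConnection Γ p V (partsInChart Γ p W) := by
  have hp := hs.self_of_nhds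
  have hΓs := fderiv_bilinear_symm (hΓ.differentiableAt (by simp)) hs
  simp only [fderiv_partsInChart_apply hΓ, partsConnection_apply, partsInChart_apply,
    liftChristoffel_apply, localCurvature, Prod.mk_sub_mk, sub_zero, map_add]
  rw [hΓs V.1 W.1, hp (Γ p.1 V.1 W.1), hp W.1 V.2, hp W.1 p.2]
  congr 1
  abel

/-- The field of endomorphisms acting as `S` on horizontal and vertical parts. -/
def liftEnd (Γ : E → E →L[ℝ] E →L[ℝ] E) (S : E × E → E × E →L[ℝ] E × E) (p : E × E) :
    E × E →L[ℝ] E × E :=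
  ((partsInChart Γ p).symm : E × E →L[ℝ] E × E) ∘L S p ∘L (partsInChart Γ p : E × E →L[ℝ] E × E)

theorem partsInChart_liftEnd (Γ : E → E →L[ℝ] E →L[ℝ] E) (S : E × E → E × E →L[ℝ] E × E)
    (p V : E × E) : partsInChart Γ p (liftEnd Γ S p V) = S p (partsInChart Γ p V) :=
  (partsInChart Γ p).apply_symm_apply _

theorem contDiffAt_liftEnd {n : WithTop ℕ∞} (hΓ : ContDiffAt ℝ n Γ p.1)
    (hS : ContDiffAt ℝ n S p) : ContDiffAt ℝ n (liftEnd Γ S) p :=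
  (contDiffAt_partsInChart_symm hΓ).clm_comp (hS.clm_comp (contDiffAt_partsInChart hΓ))

theorem partsInChart_localDerivEnd_liftEnd (hΓ : ContDiffAt ℝ 1 Γ p.1)
    (hs : ∀ᶠ z in 𝓝 p.1, ∀ a b, Γ z a b = Γ z b a) (hS : ContDiffAt ℝ 1 S p) (V W : E × E) :
    partsInChart Γ p (localDerivEnd (liftChristoffel Γ) (liftEnd Γ S) p V W) =
      localDerivEnd (partsConnection Γ) S p V (partsInChart Γ p W) :=
  localDerivEnd_gauge (P := fun q ↦ (partsInChart Γ q : E × E →L[ℝ] E × E))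
    ((contDiffAt_partsInChart hΓ).differentiableAt (by simp))
    ((contDiffAt_liftEnd hΓ hS).differentiableAt (by simp)) (hS.differentiableAt (by simp))
    (partsInChart_liftChristoffel hΓ hs)
    (Filter.Eventually.of_forall fun q ↦ partsInChart_liftEnd Γ S q) V W

theorem localDerivEnd_liftEnd_eq_zero_iff (hΓ : ContDiffAt ℝ 1 Γ p.1)
    (hs : ∀ᶠ z in 𝓝 p.1, ∀ a b, Γ z a b = Γ z b a) (hS : ContDiffAt ℝ 1 S p) :
    (∀ V W, localDerivEnd (liftChristoffel Γ) (liftEnd Γ S) p V W = 0) ↔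
      ∀ V W, localDerivEnd (partsConnection Γ) S p V W = 0 := by
  refine forall_congr' fun V ↦ (forall_congr' fun W ↦ ?_).trans
    (partsInChart Γ p).surjective.forall.symm
  rw [← partsInChart_localDerivEnd_liftEnd hΓ hs hS,
    map_eq_zero_iff _ (partsInChart Γ p).injective]

/-- The action `(a, b) ↦ (-A a, A b)` of `J₁` on horizontal and vertical parts, as a function of
the expression `A` of `J`. -/
def partsJ₁ : (E →L[ℝ] E) →L[ℝ] E × E →L[ℝ] E × E :=
  postcomp (E × E) (inr ℝ E E) ∘L precomp E (snd ℝ E E) -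
    postcomp (E × E) (inl ℝ E E) ∘L precomp E (fst ℝ E E)

/-- The action `(a, b) ↦ (-b, a)` of `J₂` on horizontal and vertical parts. -/
def partsJ₂ : E × E →L[ℝ] E × E :=
  inr ℝ E E ∘L fst ℝ E E - inl ℝ E E ∘L snd ℝ E E

/-- The action `(a, b) ↦ (A b, A a)` of `J₃` on horizontal and vertical parts, as a function of
the expression `A` of `J`. -/
def partsJ₃ : (E →L[ℝ] E) →L[ℝ] E × E →L[ℝ] E × E :=
  postcomp (E × E) (inl ℝ E E) ∘L precomp E (snd ℝ E E) +
    postcomp (E × E) (inr ℝ E E) ∘L precomp E (fst ℝ E E)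

theorem partsJ₁_apply (A : E →L[ℝ] E) (V : E × E) : partsJ₁ A V = (-A V.1, A V.2) := by
  simp [partsJ₁]

theorem partsJ₂_apply (V : E × E) : partsJ₂ V = (-V.2, V.1) := by
  simp [partsJ₂]

theorem partsJ₃_apply (A : E →L[ℝ] E) (V : E × E) : partsJ₃ A V = (A V.2, A V.1) := by
  simp [partsJ₃]

theorem localDerivEnd_partsJ₁ (hJ : DifferentiableAt ℝ J p.1) (V W : E × E) :
    localDerivEnd (partsConnection Γ) (fun q ↦ partsJ₁ (J q.1)) p V W =
      (-localDerivEnd Γ J p.1 V.1 W.1, localDerivEnd Γ J p.1 V.1 W.2 -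
        (localCurvature Γ p.1 p.2 V.1 (J p.1 W.1) + J p.1 (localCurvature Γ p.1 p.2 V.1 W.1))) := by
  simp only [localDerivEnd, fderiv_clm_comp_fst_apply _ hJ, partsJ₁_apply, partsConnection_apply,
    Prod.mk_add_mk, Prod.mk_sub_mk, map_add, map_neg, localCurvature_neg]
  congr 1 <;> abel

theorem localDerivEnd_partsJ₂ (V W : E × E) :
    localDerivEnd (partsConnection Γ) (fun _ ↦ partsJ₂) p V W =
      (localCurvature Γ p.1 p.2 V.1 W.1, -localCurvature Γ p.1 p.2 V.1 W.2) := by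
  simp only [localDerivEnd, fderiv_fun_const, Pi.zero_apply, zero_apply, zero_add, partsJ₂_apply,
    partsConnection_apply, Prod.mk_sub_mk, map_neg, localCurvature_neg]
  congr 1 <;> abel

theorem localDerivEnd_partsJ₃ (hJ : DifferentiableAt ℝ J p.1) (V W : E × E) :
    localDerivEnd (partsConnection Γ) (fun q ↦ partsJ₃ (J q.1)) p V W =
      (localDerivEnd Γ J p.1 V.1 W.2 - J p.1 (localCurvature Γ p.1 p.2 V.1 W.1),
        localDerivEnd Γ J p.1 V.1 W.1 + localCurvature Γ p.1 p.2 V.1 (J p.1 W.2)) := by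
  simp only [localDerivEnd, fderiv_clm_comp_fst_apply _ hJ, partsJ₃_apply, partsConnection_apply,
    Prod.mk_add_mk, Prod.mk_sub_mk, map_add]
  congr 1 <;> abel

theorem localDerivEnd_partsJ₁_eq_zero_iff (hJ : DifferentiableAt ℝ J p.1) :
    (∀ V W, localDerivEnd (partsConnection Γ) (fun q ↦ partsJ₁ (J q.1)) p V W = 0) ↔
      (∀ a b, localDerivEnd Γ J p.1 a b = 0) ∧ ∀ a b,
        localCurvature Γ p.1 p.2 a (J p.1 b) + J p.1 (localCurvature Γ p.1 p.2 a b) = 0 := by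
  simp only [localDerivEnd_partsJ₁ hJ, Prod.mk_eq_zero, neg_eq_zero]
  refine ⟨fun h ↦ ⟨fun a b ↦ (h (a, 0) (b, 0)).1, fun a b ↦ ?_⟩, fun h V W ↦ ?_⟩
  · simpa only [localDerivEnd_zero_right, zero_sub, neg_eq_zero] using (h (a, 0) (b, 0)).2
  · simp only [h.1, h.2, sub_zero, and_self]

theorem localDerivEnd_partsJ₂_eq_zero_iff :
    (∀ V W, localDerivEnd (partsConnection Γ) (fun _ ↦ partsJ₂) p V W = 0) ↔
      ∀ a b, localCurvature Γ p.1 p.2 a b = 0 := by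
  simp only [localDerivEnd_partsJ₂, Prod.mk_eq_zero, neg_eq_zero]
  exact ⟨fun h a b ↦ (h (a, 0) (b, 0)).1, fun h V W ↦ ⟨h _ _, h _ _⟩⟩

theorem localDerivEnd_partsJ₃_eq_zero_iff (hJ : DifferentiableAt ℝ J p.1) :
    (∀ V W, localDerivEnd (partsConnection Γ) (fun q ↦ partsJ₃ (J q.1)) p V W = 0) ↔
      (∀ a b, localDerivEnd Γ J p.1 a b = 0) ∧
      (∀ a b, J p.1 (localCurvature Γ p.1 p.2 a b) = 0) ∧
      ∀ a b, localCurvature Γ p.1 p.2 a (J p.1 b) = 0 := by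
  simp only [localDerivEnd_partsJ₃ hJ, Prod.mk_eq_zero]
  constructor
  · intro h
    have hpar (a b : E) : localDerivEnd Γ J p.1 a b = 0 := by
      simpa only [map_zero, localCurvature_zero, add_zero] using (h (a, 0) (b, 0)).2
    simp only [hpar, zero_sub, neg_eq_zero, zero_add] at h
    exact ⟨hpar, fun a b ↦ (h (a, 0) (b, 0)).1, fun a b ↦ (h (a, 0) (0, b)).2⟩
  · rintro ⟨hpar, hJR, hRJ⟩ V W
    simp only [hpar, hJR, hRJ, sub_zero, add_zero, and_self]

end LiftInChart

section TangentChart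

variable {E : Type*} [NormedAddCommGroup E] [NormedSpace ℝ E]
  {M : Type*} [TopologicalSpace M] [ChartedSpace E M] [IsManifold 𝓘(ℝ, E) ∞ M]
  {u₀ u : TangentBundle 𝓘(ℝ, E) M} {D : Connection 𝓘(ℝ, E) M} {Γ : E → E →L[ℝ] E →L[ℝ] E}
  {p : E × E}

theorem extChartAt_tangent_apply (hu : u.proj ∈ (extChartAt 𝓘(ℝ, E) u₀.proj).source) :
    extChartAt 𝓘(ℝ, E).tangent u₀ u =
      (extChartAt 𝓘(ℝ, E) u₀.proj u.proj, chartDeriv 𝓘(ℝ, E) u₀.proj u.proj u.snd) :=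
  Prod.ext rfl (trivializationAt_snd hu u.snd)

theorem mem_extChartAt_tangent_target :
    p ∈ (extChartAt 𝓘(ℝ, E).tangent u₀).target ↔
      p.1 ∈ (extChartAt 𝓘(ℝ, E) u₀.proj).target := by
  rw [extChartAt_target, extChartAt_target, ModelWithCorners.range_eq_univ,
    ModelWithCorners.range_eq_univ, Set.inter_univ, Set.inter_univ]
  exact TangentBundle.mem_chart_target_iff (I := 𝓘(ℝ, E)) p u₀

theorem mem_extChartAt_tangent_source :
    u ∈ (extChartAt 𝓘(ℝ, E).tangent u₀).source ↔
      u.proj ∈ (extChartAt 𝓘(ℝ, E) u₀.proj).source := by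
  rw [extChartAt_source, extChartAt_source]
  exact TangentBundle.mem_chart_source_iff (I := 𝓘(ℝ, E)) u u₀

theorem exists_extChartAt_tangent_eq (hp : p.1 ∈ (extChartAt 𝓘(ℝ, E) u₀.proj).target) :
    ∃ u, u.proj ∈ (extChartAt 𝓘(ℝ, E) u₀.proj).source ∧
      extChartAt 𝓘(ℝ, E).tangent u₀ u = p :=
  have hp' := mem_extChartAt_tangent_target.2 hp
  ⟨_, mem_extChartAt_tangent_source.1 ((extChartAt 𝓘(ℝ, E).tangent u₀).map_target hp'),
    (extChartAt 𝓘(ℝ, E).tangent u₀).right_inv hp'⟩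

theorem mdifferentiableAt_extChartAt_tangent
    (hu : u.proj ∈ (extChartAt 𝓘(ℝ, E) u₀.proj).source) :
    MDifferentiableAt 𝓘(ℝ, E).tangent 𝓘(ℝ, E × E) (extChartAt 𝓘(ℝ, E).tangent u₀) u :=
  mdifferentiableAt_extChartAt (I := 𝓘(ℝ, E).tangent)
    (extChartAt_source 𝓘(ℝ, E).tangent u₀ ▸ mem_extChartAt_tangent_source.2 hu)

theorem chartDeriv_verticalLift (hu : u.proj ∈ (extChartAt 𝓘(ℝ, E) u₀.proj).source)
    (b : TangentSpace 𝓘(ℝ, E) u.proj) :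
    chartDeriv 𝓘(ℝ, E).tangent u₀ u (verticalLift u b) =
      (0, chartDeriv 𝓘(ℝ, E) u₀.proj u.proj b) := by
  let T : E →L[ℝ] E := chartDeriv 𝓘(ℝ, E) u₀.proj u.proj
  let fibreInclusion : E → TangentBundle 𝓘(ℝ, E) M :=
    fun w ↦ TotalSpace.mk' E u.proj w
  have hcomp : extChartAt 𝓘(ℝ, E).tangent u₀ ∘ fibreInclusion =
      fun w ↦ (extChartAt 𝓘(ℝ, E) u₀.proj u.proj, T w) :=
    funext fun w ↦ extChartAt_tangent_apply (u := TotalSpace.mk' E u.proj w) hu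
  have hchain := mfderiv_comp (I := 𝓘(ℝ, E)) (f := fibreInclusion) (show E from u.snd)
    (mdifferentiableAt_extChartAt_tangent hu) (mdifferentiableAt_fibreInclusion u.proj _)
  rw [hcomp, mfderiv_eq_fderiv, ((hasFDerivAt_const _ _).prodMk T.hasFDerivAt).fderiv] at hchain
  rw [chartDeriv_eq_mfderiv (mem_extChartAt_tangent_source.2 hu)]
  exact (congrArg (fun L : E →L[ℝ] E × E ↦ L b) hchain).symm

theorem chartDeriv_mfderiv_section {σ : ∀ x : M, TangentSpace 𝓘(ℝ, E) x}
    (hσu : σ u.proj = u.snd) (hu : u.proj ∈ (extChartAt 𝓘(ℝ, E) u₀.proj).source)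
    (hσ : MDifferentiableAt 𝓘(ℝ, E) 𝓘(ℝ, E).tangent (fun x ↦ TotalSpace.mk' E x (σ x)) u.proj)
    (a : TangentSpace 𝓘(ℝ, E) u.proj) :
    chartDeriv 𝓘(ℝ, E).tangent u₀ u
        (mfderiv 𝓘(ℝ, E) 𝓘(ℝ, E).tangent (fun x ↦ TotalSpace.mk' E x (σ x)) u.proj a) =
      (chartDeriv 𝓘(ℝ, E) u₀.proj u.proj a, fderiv ℝ (fieldInChart u₀.proj σ)
        (extChartAt 𝓘(ℝ, E) u₀.proj u.proj) (chartDeriv 𝓘(ℝ, E) u₀.proj u.proj a)) := by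
  obtain ⟨x, w⟩ := u
  obtain rfl : σ x = w := hσu
  have hchart := mdifferentiableAt_extChartAt_tangent hu
  have hchain := mfderiv_comp (I'' := 𝓘(ℝ, E × E)) x hchart hσ
  have hcomp : (fun z ↦ (extChartAt 𝓘(ℝ, E).tangent u₀ ∘ fun x ↦ TotalSpace.mk' E x (σ x))
      ((extChartAt 𝓘(ℝ, E) u₀.proj).symm z)) =ᶠ[𝓝 (extChartAt 𝓘(ℝ, E) u₀.proj x)]
      fun z ↦ (z, fieldInChart u₀.proj σ z) := by
    filter_upwards [extChartAt_target_mem_nhds' ((extChartAt _ _).map_source hu)] with z hz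
    refine (extChartAt_tangent_apply (u := TotalSpace.mk' E _ (σ _))
      ((extChartAt _ _).map_target hz)).trans ?_
    exact Prod.ext ((extChartAt 𝓘(ℝ, E) u₀.proj).right_inv hz) rfl
  have hderiv := mvfderiv_eq_fderiv_chartDeriv hu (hchart.comp x hσ) a
  rw [hcomp.fderiv_eq] at hderiv
  replace hderiv := hderiv.trans (congrArg (fun L : E →L[ℝ] E × E ↦ L _)
    ((hasFDerivAt_id _).prodMk (differentiableAt_fieldInChart hu hσ).hasFDerivAt).fderiv)
  rw [chartDeriv_eq_mfderiv (mem_extChartAt_tangent_source.2 hu)]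
  exact (congrArg (fun L : E →L[ℝ] E × E ↦ L a) hchain).symm.trans hderiv

theorem chartDeriv_horizontalLift (hD : HasChristoffel D u₀.proj Γ)
    (hu : u.proj ∈ (extChartAt 𝓘(ℝ, E) u₀.proj).source) (a : TangentSpace 𝓘(ℝ, E) u.proj) :
    chartDeriv 𝓘(ℝ, E).tangent u₀ u (horizontalLift D u a) =
      (chartDeriv 𝓘(ℝ, E) u₀.proj u.proj a,
        -Γ (extChartAt 𝓘(ℝ, E) u₀.proj u.proj) (chartDeriv 𝓘(ℝ, E) u₀.proj u.proj a)
          (chartDeriv 𝓘(ℝ, E) u₀.proj u.proj u.snd)) := by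
  let σ : ∀ x : M, TangentSpace 𝓘(ℝ, E) x := FiberBundle.extend E u.snd
  have hσ : MDifferentiableAt 𝓘(ℝ, E) 𝓘(ℝ, E).tangent (fun x ↦ TotalSpace.mk' E x (σ x)) u.proj :=
    FiberBundle.mdifferentiableAt_extend ..
  have hσu : σ u.proj = u.snd := by simp [σ]
  have hcov := hD u.proj hu σ hσ a
  rw [localCov_apply, fieldInChart_extChartAt hu, hσu] at hcov
  have hsub : chartDeriv 𝓘(ℝ, E).tangent u₀ u (horizontalLift D u a) =
      chartDeriv 𝓘(ℝ, E).tangent u₀ u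
          (mfderiv 𝓘(ℝ, E) 𝓘(ℝ, E).tangent (fun x ↦ TotalSpace.mk' E x (σ x)) u.proj a) -
        chartDeriv 𝓘(ℝ, E).tangent u₀ u (verticalLift u (D σ u.proj a)) := map_sub _ _ _
  rw [hsub, chartDeriv_mfderiv_section hσu hu hσ, chartDeriv_verticalLift hu, hcov]
  simp

end TangentChart

section LiftedFields

variable {E : Type*} [NormedAddCommGroup E] [NormedSpace ℝ E] [FiniteDimensional ℝ E]
  {M : Type*} [TopologicalSpace M] [ChartedSpace E M] [IsManifold 𝓘(ℝ, E) ∞ M]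
  {u₀ u : TangentBundle 𝓘(ℝ, E) M} {D : Connection 𝓘(ℝ, E) M} {Γ : E → E →L[ℝ] E →L[ℝ] E}
  {p : E × E}

theorem horizontalLift_add_verticalLift_parts (D : Connection 𝓘(ℝ, E) M)
    (u : TangentBundle 𝓘(ℝ, E) M) (V : TangentSpace 𝓘(ℝ, E).tangent u) :
    horizontalLift D u (parts D u V).1 + verticalLift u (parts D u V).2 = V :=
  (liftSum_isInvertible D u).self_apply_inverse V

theorem parts_injective (D : Connection 𝓘(ℝ, E) M) (u : TangentBundle 𝓘(ℝ, E) M) :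
    Function.Injective (parts D u) := by
  intro V W h
  rw [← horizontalLift_add_verticalLift_parts D u V, h, horizontalLift_add_verticalLift_parts]

theorem parts_liftJ₁ (D : Connection 𝓘(ℝ, E) M) (J : EndField 𝓘(ℝ, E) M)
    (u : TangentBundle 𝓘(ℝ, E) M) (V : TangentSpace 𝓘(ℝ, E).tangent u) :
    parts D u (liftJ₁ D J u V) = (-J u.proj (parts D u V).1, J u.proj (parts D u V).2) := by
  nth_rewrite 1 [← horizontalLift_add_verticalLift_parts D u V]
  rw [map_add, liftJ₁_horizontal, liftJ₁_vertical, map_add, map_neg, parts_horizontal,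
    parts_vertical]
  simp

theorem parts_liftJ₂ (D : Connection 𝓘(ℝ, E) M)
    (u : TangentBundle 𝓘(ℝ, E) M) (V : TangentSpace 𝓘(ℝ, E).tangent u) :
    parts D u (liftJ₂ D u V) = (-(parts D u V).2, (parts D u V).1) := by
  nth_rewrite 1 [← horizontalLift_add_verticalLift_parts D u V]
  rw [map_add, liftJ₂_horizontal, liftJ₂_vertical, map_add, map_neg, parts_horizontal,
    parts_vertical]
  simp

theorem parts_liftJ₃ (D : Connection 𝓘(ℝ, E) M) (J : EndField 𝓘(ℝ, E) M)
    (u : TangentBundle 𝓘(ℝ, E) M) (V : TangentSpace 𝓘(ℝ, E).tangent u) :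
    parts D u (liftJ₃ D J u V) = (J u.proj (parts D u V).2, J u.proj (parts D u V).1) := by
  nth_rewrite 1 [← horizontalLift_add_verticalLift_parts D u V]
  rw [map_add, liftJ₃_horizontal, liftJ₃_vertical, map_add, parts_horizontal, parts_vertical]
  simp

/-- The horizontal and vertical parts of a tangent vector of the tangent bundle, read in the chart
of the base at `x₀`. -/
def chartParts (D : Connection 𝓘(ℝ, E) M) (x₀ : M) (u : TangentBundle 𝓘(ℝ, E) M)
    (V : TangentSpace 𝓘(ℝ, E).tangent u) : E × E :=
  (chartDeriv 𝓘(ℝ, E) x₀ u.proj (parts D u V).1, chartDeriv 𝓘(ℝ, E) x₀ u.proj (parts D u V).2)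

theorem partsInChart_chartDeriv (hD : HasChristoffel D u₀.proj Γ)
    (hu : u.proj ∈ (extChartAt 𝓘(ℝ, E) u₀.proj).source) (V : TangentSpace 𝓘(ℝ, E).tangent u) :
    partsInChart Γ (extChartAt 𝓘(ℝ, E).tangent u₀ u) (chartDeriv 𝓘(ℝ, E).tangent u₀ u V) =
      chartParts D u₀.proj u V := by
  nth_rewrite 1 [← horizontalLift_add_verticalLift_parts D u V]
  rw [map_add, chartDeriv_verticalLift hu, chartDeriv_horizontalLift hD hu, partsInChart_apply,
    extChartAt_tangent_apply hu]
  simp [chartParts]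

/-- On horizontal and vertical parts, the field `K` of endomorphisms of the tangent bundle acts in
the chart of the base at `x₀` as `S x₀ (z, w)`, at the tangent vector `w` at `z`. -/
def HasPartsExpression (D : Connection 𝓘(ℝ, E) M)
    (K : EndField 𝓘(ℝ, E).tangent (TangentBundle 𝓘(ℝ, E) M))
    (S : M → E × E → E × E →L[ℝ] E × E) : Prop :=
  ∀ (x₀ : M) (u : TangentBundle 𝓘(ℝ, E) M), u.proj ∈ (extChartAt 𝓘(ℝ, E) x₀).source →
    ∀ V, chartParts D x₀ u (K u V) =
      S x₀ (extChartAt 𝓘(ℝ, E) x₀ u.proj, chartDeriv 𝓘(ℝ, E) x₀ u.proj u.snd) (chartParts D x₀ u V)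

theorem hasPartsExpression_liftJ₁ (D : Connection 𝓘(ℝ, E) M) (J : EndField 𝓘(ℝ, E) M) :
    HasPartsExpression D (liftJ₁ D J) fun x₀ p ↦ partsJ₁ (endInChart x₀ J p.1) := fun x₀ u hu V ↦ by
  simp only [chartParts, parts_liftJ₁, partsJ₁_apply, endInChart_extChartAt_chartDeriv hu, map_neg]

theorem hasPartsExpression_liftJ₂ (D : Connection 𝓘(ℝ, E) M) :
    HasPartsExpression D (liftJ₂ D) fun _ _ ↦ partsJ₂ := fun x₀ u _ V ↦ by
  simp only [chartParts, parts_liftJ₂, partsJ₂_apply, map_neg]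

theorem hasPartsExpression_liftJ₃ (D : Connection 𝓘(ℝ, E) M) (J : EndField 𝓘(ℝ, E) M) :
    HasPartsExpression D (liftJ₃ D J) fun x₀ p ↦ partsJ₃ (endInChart x₀ J p.1) := fun x₀ u hu V ↦ by
  simp only [chartParts, parts_liftJ₃, partsJ₃_apply, endInChart_extChartAt_chartDeriv hu]

theorem HasPartsExpression.endInChart_eq_liftEnd
    {K : EndField 𝓘(ℝ, E).tangent (TangentBundle 𝓘(ℝ, E) M)} {S : M → E × E → E × E →L[ℝ] E × E}
    (hK : HasPartsExpression D K S) (hD : HasChristoffel D u₀.proj Γ)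
    (hp : p.1 ∈ (extChartAt 𝓘(ℝ, E) u₀.proj).target) :
    endInChart u₀ K p = liftEnd Γ (S u₀.proj) p := by
  obtain ⟨u, hu, rfl⟩ := exists_extChartAt_tangent_eq hp
  have hu' := mem_extChartAt_tangent_source.2 hu
  refine ContinuousLinearMap.ext fun W ↦
    (partsInChart Γ (extChartAt 𝓘(ℝ, E).tangent u₀ u)).injective ?_
  rw [partsInChart_liftEnd, ← chartDeriv_chartDerivSymm hu' W,
    endInChart_extChartAt_chartDeriv hu', partsInChart_chartDeriv hD hu,
    partsInChart_chartDeriv hD hu, hK _ u hu, extChartAt_tangent_apply hu]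

theorem formInChart_completeLift {g : FormField 𝓘(ℝ, E) M} (hD : HasChristoffel D u₀.proj Γ)
    (hp : p.1 ∈ (extChartAt 𝓘(ℝ, E) u₀.proj).target)
    (hΓ : IsChristoffel (formInChart u₀.proj g) Γ p.1) :
    formInChart u₀ (completeLift D g) p = liftMetric (formInChart u₀.proj g) p := by
  obtain ⟨u, hu, rfl⟩ := exists_extChartAt_tangent_eq hp
  have hu' := mem_extChartAt_tangent_source.2 hu
  have hfst : (extChartAt 𝓘(ℝ, E).tangent u₀ u).1 = extChartAt 𝓘(ℝ, E) u₀.proj u.proj :=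
    congrArg Prod.fst (extChartAt_tangent_apply hu)
  refine ContinuousLinearMap.ext fun V ↦ ContinuousLinearMap.ext fun W ↦ ?_
  have hparts (V : E × E) : chartParts D u₀.proj u (chartDerivSymm 𝓘(ℝ, E).tangent u₀ u V) =
      partsInChart Γ (extChartAt 𝓘(ℝ, E).tangent u₀ u) V := by
    rw [← partsInChart_chartDeriv hD hu, chartDeriv_chartDerivSymm hu']
  simp only [chartParts, partsInChart_apply, Prod.mk.injEq] at hparts
  rw [formInChart_extChartAt hu', completeLift_apply, ← formInChart_extChartAt_chartDeriv hu,
    ← formInChart_extChartAt_chartDeriv hu, (hparts V).1, (hparts V).2, (hparts W).1, (hparts W).2,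
    ← hfst, liftMetric_apply, hΓ.compat, hΓ.symm _ V.1, hΓ.symm _ W.1]
  simp only [map_add, add_apply]
  ring

end LiftedFields

section Criteria

variable {F : Type*} [NormedAddCommGroup F] [NormedSpace ℝ F]
  {H : Type*} [TopologicalSpace H] {I : ModelWithCorners ℝ F H}
  {N : Type*} [TopologicalSpace N] [ChartedSpace H N] [IsManifold I ∞ N] {g : FormField I N}
  {J : EndField I N}

theorem IsAlmostComplex.endInChart_endInChart (hJ : IsAlmostComplex J) {x₀ : N} {z : F}
    (hz : z ∈ (extChartAt I x₀).target) (a : F) :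
    endInChart x₀ J z (endInChart x₀ J z a) = -a := by
  have hx := (extChartAt I x₀).map_target hz
  rw [endInChart_apply, endInChart_apply, chartDerivSymm_chartDeriv hx, hJ.sq, map_neg,
    chartDeriv_chartDerivSymm hx]

theorem IsAlmostComplex.endInChart_eq_zero_iff (hJ : IsAlmostComplex J) {x₀ : N} {z : F}
    (hz : z ∈ (extChartAt I x₀).target) {a : F} : endInChart x₀ J z a = 0 ↔ a = 0 := by
  refine ⟨fun h ↦ ?_, fun h ↦ by rw [h, map_zero]⟩
  rw [← neg_eq_zero, ← hJ.endInChart_endInChart hz, h, map_zero]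

variable [FiniteDimensional ℝ F]

theorem structureTensorVanishes_iff_isParallel (hg : IsPseudoRiemannian g) (J : EndField I N) :
    StructureTensorVanishes g J ↔ IsParallel (leviCivita g) J :=
  ⟨fun h x v Y hY ↦ hg.nondegenerate _ _ fun w ↦ h x v w Y hY,
    fun h x v w Y hY ↦ by rw [h x v Y hY, map_zero, zero_apply]⟩

variable [I.Boundaryless]

theorem hasChristoffel_leviCivita_christoffel (hg : IsPseudoRiemannian g) (x₀ : N) :
    HasChristoffel (leviCivita g) x₀ (christoffel (formInChart x₀ g)) :=
  hasChristoffel_leviCivita hg fun _ hz ↦ isChristoffel_formInChart hg hz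

theorem isFlat_iff_localCurvature_eq_zero (hg : IsPseudoRiemannian g) :
    IsFlat (leviCivita g) ↔ ∀ x₀ : N, ∀ z ∈ (extChartAt I x₀).target, ∀ a b c,
      localCurvature (christoffel (formInChart x₀ g)) z a b c = 0 :=
  ⟨fun h x₀ _ hz ↦ h.localCurvature_eq_zero (hasChristoffel_leviCivita_christoffel hg x₀)
    (contDiffOn_christoffel_formInChart hg x₀) hz,
  fun h ↦ isFlat_of_localCurvature_eq_zero fun x₀ ↦
    ⟨_, hasChristoffel_leviCivita_christoffel hg x₀, contDiffOn_christoffel_formInChart hg x₀,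
      h x₀ _ (mem_extChartAt_target x₀)⟩⟩

theorem isParallel_iff_localDerivEnd_eq_zero (hg : IsPseudoRiemannian g) (hJ : SmoothEnd J) :
    IsParallel (leviCivita g) J ↔ ∀ x₀ : N, ∀ z ∈ (extChartAt I x₀).target, ∀ a b,
      localDerivEnd (christoffel (formInChart x₀ g)) (endInChart x₀ J) z a b = 0 :=
  ⟨fun h x₀ _ hz ↦ h.localDerivEnd_eq_zero (hasChristoffel_leviCivita_christoffel hg x₀) hJ hz,
  fun h ↦ isParallel_of_localDerivEnd_eq_zero hJ fun x₀ ↦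
    ⟨_, hasChristoffel_leviCivita_christoffel hg x₀, h x₀ _ (mem_extChartAt_target x₀)⟩⟩

theorem IsParallel.localCurvature_endInChart (hg : IsPseudoRiemannian g) (hJ : SmoothEnd J)
    (h : IsParallel (leviCivita g) J) {x₀ : N} {z : F} (hz : z ∈ (extChartAt I x₀).target)
    (a b c : F) :
    localCurvature (christoffel (formInChart x₀ g)) z a b (endInChart x₀ J z c) =
      endInChart x₀ J z (localCurvature (christoffel (formInChart x₀ g)) z a b c) := by
  have htarget := extChartAt_target_mem_nhds' hz
  refine localCurvature_comm_of_localDerivEnd_eq_zero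
    (((contDiffOn_christoffel_formInChart hg x₀).contDiffAt htarget).of_le (by simp))
    (((contDiffOn_endInChart hJ x₀).contDiffAt htarget).of_le ENat.LEInfty.out) ?_ a b c
  filter_upwards [htarget] with y hy
  exact (isParallel_iff_localDerivEnd_eq_zero hg hJ).1 h x₀ y hy

end Criteria

section TangentBundle

variable {E : Type*} [NormedAddCommGroup E] [NormedSpace ℝ E] [FiniteDimensional ℝ E]
  {M : Type*} [TopologicalSpace M] [ChartedSpace E M] [IsManifold 𝓘(ℝ, E) ∞ M]
  {g : FormField 𝓘(ℝ, E) M} {J : EndField 𝓘(ℝ, E) M}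
  {K : EndField 𝓘(ℝ, E).tangent (TangentBundle 𝓘(ℝ, E) M)} {S : M → E × E → E × E →L[ℝ] E × E}
  {u₀ : TangentBundle 𝓘(ℝ, E) M} {p : E × E}

theorem formInChart_completeLift_eventuallyEq (hg : IsPseudoRiemannian g)
    (hp : p.1 ∈ (extChartAt 𝓘(ℝ, E) u₀.proj).target) :
    formInChart u₀ (completeLift (leviCivita g) g) =ᶠ[𝓝 p]
      liftMetric (formInChart u₀.proj g) := by
  filter_upwards [continuousAt_fst.eventually_mem (extChartAt_target_mem_nhds' hp)] with q hq
  exact formInChart_completeLift (hasChristoffel_leviCivita_christoffel hg u₀.proj) hq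
    (isChristoffel_formInChart hg hq)

theorem isPseudoRiemannian_completeLift (hg : IsPseudoRiemannian g) :
    IsPseudoRiemannian (completeLift (leviCivita g) g) where
  smooth := by
    refine smoothForm_of_contDiffAt_formInChart fun u₀ ↦ ?_
    have hp := mem_extChartAt_tangent_target.1 (mem_extChartAt_target (I := 𝓘(ℝ, E).tangent) u₀)
    exact (contDiffAt_liftMetric ((contDiffOn_formInChart hg.smooth u₀.proj).contDiffAt
      (extChartAt_target_mem_nhds' hp)) (by simp)).congr_of_eventuallyEq
      (formInChart_completeLift_eventuallyEq hg hp)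
  symm u V W := by
    rw [completeLift_apply, completeLift_apply, hg.symm _ (parts _ u V).1,
      hg.symm _ (parts _ u V).2, add_comm]
  nondegenerate u V h := by
    refine parts_injective (leviCivita g) u ?_
    rw [map_zero]
    refine Prod.ext (hg.nondegenerate _ _ fun w ↦ ?_) (hg.nondegenerate _ _ fun w ↦ ?_)
    · simpa [completeLift_apply, parts_vertical] using h (verticalLift u w)
    · simpa [completeLift_apply, parts_horizontal] using h (horizontalLift (leviCivita g) u w)

theorem hasChristoffel_completeLift (hg : IsPseudoRiemannian g) (u₀ : TangentBundle 𝓘(ℝ, E) M) :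
    HasChristoffel (leviCivita (completeLift (leviCivita g) g)) u₀
      (liftChristoffel (christoffel (formInChart u₀.proj g))) := by
  refine hasChristoffel_leviCivita (isPseudoRiemannian_completeLift hg) fun p hp ↦ ?_
  rw [mem_extChartAt_tangent_target] at hp
  have htarget := extChartAt_target_mem_nhds' hp
  have hlift := isChristoffel_liftChristoffel
    (((contDiffOn_formInChart hg.smooth u₀.proj).contDiffAt htarget).of_le
      ENat.LEInfty.out)
    (((contDiffOn_christoffel_formInChart hg u₀.proj).contDiffAt htarget).differentiableAt
      (by simp))
    (Filter.eventually_of_mem htarget fun _ hz ↦ isChristoffel_formInChart hg hz)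
  have hcongr := formInChart_completeLift_eventuallyEq hg hp
  exact ⟨hlift.symm, fun a b c ↦ by rw [hcongr.fderiv_eq, hcongr.self_of_nhds, hlift.compat]⟩

theorem HasPartsExpression.endInChart_eventuallyEq_liftEnd (hg : IsPseudoRiemannian g)
    (hK : HasPartsExpression (leviCivita g) K S)
    (hp : p.1 ∈ (extChartAt 𝓘(ℝ, E) u₀.proj).target) :
    endInChart u₀ K =ᶠ[𝓝 p] liftEnd (christoffel (formInChart u₀.proj g)) (S u₀.proj) := by
  filter_upwards [continuousAt_fst.eventually_mem (extChartAt_target_mem_nhds' hp)] with q hq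
  exact hK.endInChart_eq_liftEnd (hasChristoffel_leviCivita_christoffel hg u₀.proj) hq

theorem HasPartsExpression.smoothEnd (hg : IsPseudoRiemannian g)
    (hK : HasPartsExpression (leviCivita g) K S)
    (hS : ∀ x₀ p, p.1 ∈ (extChartAt 𝓘(ℝ, E) x₀).target → ContDiffAt ℝ ∞ (S x₀) p) :
    SmoothEnd K := by
  refine smoothEnd_of_contDiffAt_endInChart fun u₀ ↦ ?_
  have hp := mem_extChartAt_tangent_target.1 (mem_extChartAt_target (I := 𝓘(ℝ, E).tangent) u₀)
  exact (contDiffAt_liftEnd ((contDiffOn_christoffel_formInChart hg u₀.proj).contDiffAt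
    (extChartAt_target_mem_nhds' hp)) (hS _ _ hp)).congr_of_eventuallyEq
    (hK.endInChart_eventuallyEq_liftEnd hg hp)

theorem HasPartsExpression.localDerivEnd_eq_zero_iff (hg : IsPseudoRiemannian g)
    (hK : HasPartsExpression (leviCivita g) K S)
    (hp : p.1 ∈ (extChartAt 𝓘(ℝ, E) u₀.proj).target) (hS : ContDiffAt ℝ 1 (S u₀.proj) p) :
    (∀ V W, localDerivEnd (liftChristoffel (christoffel (formInChart u₀.proj g)))
        (endInChart u₀ K) p V W = 0) ↔
      ∀ V W, localDerivEnd (partsConnection (christoffel (formInChart u₀.proj g)))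
        (S u₀.proj) p V W = 0 := by
  have htarget := extChartAt_target_mem_nhds' hp
  simp only [localDerivEnd_congr (hK.endInChart_eventuallyEq_liftEnd hg hp)]
  exact localDerivEnd_liftEnd_eq_zero_iff
    (((contDiffOn_christoffel_formInChart hg u₀.proj).contDiffAt htarget).of_le (by simp))
    (Filter.eventually_of_mem htarget fun _ hz ↦ (isChristoffel_formInChart hg hz).symm) hS

theorem HasPartsExpression.isParallel_iff (hg : IsPseudoRiemannian g)
    (hK : HasPartsExpression (leviCivita g) K S)
    (hS : ∀ x₀ p, p.1 ∈ (extChartAt 𝓘(ℝ, E) x₀).target → ContDiffAt ℝ ∞ (S x₀) p) :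
    IsParallel (leviCivita (completeLift (leviCivita g) g)) K ↔
      ∀ x₀ p, p.1 ∈ (extChartAt 𝓘(ℝ, E) x₀).target → ∀ V W,
        localDerivEnd (partsConnection (christoffel (formInChart x₀ g))) (S x₀) p V W = 0 := by
  have hiff (u₀ : TangentBundle 𝓘(ℝ, E) M) {p : E × E}
      (hp : p.1 ∈ (extChartAt 𝓘(ℝ, E) u₀.proj).target) :=
    hK.localDerivEnd_eq_zero_iff hg hp ((hS _ _ hp).of_le (by simp))
  have hKs := hK.smoothEnd hg hS
  refine ⟨fun h x₀ p hp ↦ ?_, fun h ↦ ?_⟩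
  · let u₀ : TangentBundle 𝓘(ℝ, E) M := TotalSpace.mk' E x₀ 0
    exact (hiff u₀ hp).1 (h.localDerivEnd_eq_zero (hasChristoffel_completeLift hg u₀) hKs
      (mem_extChartAt_tangent_target.2 hp))
  · refine isParallel_of_localDerivEnd_eq_zero hKs fun u₀ ↦
      ⟨_, hasChristoffel_completeLift hg u₀, ?_⟩
    have hp := mem_extChartAt_tangent_target.1 (mem_extChartAt_target (I := 𝓘(ℝ, E).tangent) u₀)
    exact (hiff u₀ hp).2 (h _ _ hp)

theorem contDiffAt_clm_comp_endInChart (L : (E →L[ℝ] E) →L[ℝ] E × E →L[ℝ] E × E)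
    (hJ : SmoothEnd J) (x₀ : M) (p : E × E) (hp : p.1 ∈ (extChartAt 𝓘(ℝ, E) x₀).target) :
    ContDiffAt ℝ ∞ (fun q : E × E ↦ L (endInChart x₀ J q.1)) p :=
  contDiffAt_clm_comp_fst L
    ((contDiffOn_endInChart hJ x₀).contDiffAt (extChartAt_target_mem_nhds' hp))

theorem differentiableAt_endInChart (hJ : SmoothEnd J) {x₀ : M} {z : E}
    (hz : z ∈ (extChartAt 𝓘(ℝ, E) x₀).target) : DifferentiableAt ℝ (endInChart x₀ J) z :=
  ((contDiffOn_endInChart hJ x₀).contDiffAt (extChartAt_target_mem_nhds' hz)).differentiableAt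
    (by simp)

theorem isAlmostComplex_liftJ₁ (hg : IsPseudoRiemannian g) (hJ : IsAlmostComplex J) :
    IsAlmostComplex (liftJ₁ (leviCivita g) J) where
  smooth := (hasPartsExpression_liftJ₁ _ J).smoothEnd hg
    (contDiffAt_clm_comp_endInChart partsJ₁ hJ.smooth)
  sq u V := parts_injective (leviCivita g) u <| by
    rw [parts_liftJ₁, parts_liftJ₁, map_neg (parts (leviCivita g) u), map_neg, hJ.sq, hJ.sq,
      neg_neg]
    simp [Prod.ext_iff]

theorem isAlmostComplex_liftJ₂ (hg : IsPseudoRiemannian g) :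
    IsAlmostComplex (liftJ₂ (leviCivita g)) where
  smooth := (hasPartsExpression_liftJ₂ _).smoothEnd hg fun _ _ _ ↦ contDiffAt_const
  sq u V := parts_injective (leviCivita g) u <| by
    rw [parts_liftJ₂, parts_liftJ₂, map_neg (parts (leviCivita g) u)]
    simp [Prod.ext_iff]

theorem isAlmostComplex_liftJ₃ (hg : IsPseudoRiemannian g) (hJ : IsAlmostComplex J) :
    IsAlmostComplex (liftJ₃ (leviCivita g) J) where
  smooth := (hasPartsExpression_liftJ₃ _ J).smoothEnd hg
    (contDiffAt_clm_comp_endInChart partsJ₃ hJ.smooth)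
  sq u V := parts_injective (leviCivita g) u <| by
    rw [parts_liftJ₃, parts_liftJ₃, map_neg (parts (leviCivita g) u), hJ.sq, hJ.sq]
    simp [Prod.ext_iff]

theorem isParallel_liftJ₁_iff (hg : IsPseudoRiemannian g) (hJ : IsAlmostComplex J) :
    IsParallel (leviCivita (completeLift (leviCivita g) g)) (liftJ₁ (leviCivita g) J) ↔
      IsFlat (leviCivita g) ∧ IsParallel (leviCivita g) J := by
  have hparallel := isParallel_iff_localDerivEnd_eq_zero hg hJ.smooth
  rw [(hasPartsExpression_liftJ₁ _ J).isParallel_iff hg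
    (contDiffAt_clm_comp_endInChart partsJ₁ hJ.smooth), isFlat_iff_localCurvature_eq_zero hg]
  have hiff (x₀ : M) {p : E × E} (hp : p.1 ∈ (extChartAt 𝓘(ℝ, E) x₀).target) :=
    localDerivEnd_partsJ₁_eq_zero_iff (Γ := christoffel (formInChart x₀ g))
      (differentiableAt_endInChart hJ.smooth hp)
  constructor
  · intro h
    have hJpar : IsParallel (leviCivita g) J := hparallel.2 fun x₀ z hz ↦
      ((hiff x₀ (p := (z, 0)) hz).1 (h x₀ _ hz)).1
    refine ⟨fun x₀ z hz a b c ↦ ?_, hJpar⟩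
    have hanticomm := ((hiff x₀ (p := (z, a)) hz).1 (h x₀ _ hz)).2 b c
    rw [hJpar.localCurvature_endInChart hg hJ.smooth hz, ← two_smul ℝ, smul_eq_zero] at hanticomm
    exact (hJ.endInChart_eq_zero_iff hz).1 (hanticomm.resolve_left two_ne_zero)
  · rintro ⟨hflat, hJpar⟩ x₀ p hp
    refine (hiff x₀ hp).2 ⟨hparallel.1 hJpar x₀ _ hp, fun a b ↦ ?_⟩
    rw [hflat x₀ _ hp, hflat x₀ _ hp, map_zero, add_zero]

theorem isParallel_liftJ₂_iff (hg : IsPseudoRiemannian g) :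
    IsParallel (leviCivita (completeLift (leviCivita g) g)) (liftJ₂ (leviCivita g)) ↔
      IsFlat (leviCivita g) := by
  rw [(hasPartsExpression_liftJ₂ _).isParallel_iff hg fun _ _ _ ↦ contDiffAt_const,
    isFlat_iff_localCurvature_eq_zero hg]
  simp only [localDerivEnd_partsJ₂_eq_zero_iff]
  exact ⟨fun h x₀ z hz a ↦ h x₀ (z, a) hz, fun h x₀ p hp ↦ h x₀ _ hp p.2⟩

theorem isParallel_liftJ₃_iff (hg : IsPseudoRiemannian g) (hJ : IsAlmostComplex J) :
    IsParallel (leviCivita (completeLift (leviCivita g) g)) (liftJ₃ (leviCivita g) J) ↔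
      IsFlat (leviCivita g) ∧ IsParallel (leviCivita g) J := by
  rw [(hasPartsExpression_liftJ₃ _ J).isParallel_iff hg
    (contDiffAt_clm_comp_endInChart partsJ₃ hJ.smooth), isFlat_iff_localCurvature_eq_zero hg,
    isParallel_iff_localDerivEnd_eq_zero hg hJ.smooth]
  have hiff (x₀ : M) {p : E × E} (hp : p.1 ∈ (extChartAt 𝓘(ℝ, E) x₀).target) :=
    localDerivEnd_partsJ₃_eq_zero_iff (Γ := christoffel (formInChart x₀ g))
      (differentiableAt_endInChart hJ.smooth hp)
  constructor
  · intro h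
    exact ⟨fun x₀ z hz a b c ↦ (hJ.endInChart_eq_zero_iff hz).1
        (((hiff x₀ (p := (z, a)) hz).1 (h x₀ _ hz)).2.1 b c),
      fun x₀ z hz ↦ ((hiff x₀ (p := (z, 0)) hz).1 (h x₀ _ hz)).1⟩
  · rintro ⟨hflat, hJpar⟩ x₀ p hp
    refine (hiff x₀ hp).2 ⟨hJpar x₀ _ hp, fun a b ↦ ?_, fun a b ↦ hflat x₀ _ hp _ _ _⟩
    rw [hflat x₀ _ hp, map_zero]

theorem isAlmostHypercomplex_lift (hg : IsPseudoRiemannian g) (hJ : IsAlmostComplex J) :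
    IsAlmostHypercomplex (liftJ₁ (leviCivita g) J) (liftJ₂ (leviCivita g))
      (liftJ₃ (leviCivita g) J) where
  almostComplex₁ := isAlmostComplex_liftJ₁ hg hJ
  almostComplex₂ := isAlmostComplex_liftJ₂ hg
  almostComplex₃ := isAlmostComplex_liftJ₃ hg hJ
  comp_eq u V := parts_injective (leviCivita g) u <| by
    simp [parts_liftJ₁, parts_liftJ₂, parts_liftJ₃]
  anticomm₁₂ u V := parts_injective (leviCivita g) u <| by simp [parts_liftJ₁, parts_liftJ₂]
  anticomm₂₃ u V := parts_injective (leviCivita g) u <| by simp [parts_liftJ₂, parts_liftJ₃]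
  anticomm₃₁ u V := parts_injective (leviCivita g) u <| by simp [parts_liftJ₁, parts_liftJ₃]

theorem isAlmostHypercomplexHermitianNorden_lift (hJg : IsAlmostNorden J g) :
    IsAlmostHypercomplexHermitianNorden (liftJ₁ (leviCivita g) J) (liftJ₂ (leviCivita g))
      (liftJ₃ (leviCivita g) J) (completeLift (leviCivita g) g) where
  hypercomplex := isAlmostHypercomplex_lift hJg.metric hJg.almostComplex
  metric := isPseudoRiemannian_completeLift hJg.metric
  hermitian₁ u V W := by simp [completeLift_apply, parts_liftJ₁, hJg.anti_isometry]
  norden₂ u V W := by simp [completeLift_apply, parts_liftJ₂]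
  norden₃ u V W := by simp [completeLift_apply, parts_liftJ₃, hJg.anti_isometry]

theorem isPseudoHyperKahler_lift_iff (hJg : IsAlmostNorden J g) :
    IsPseudoHyperKahler (liftJ₁ (leviCivita g) J) (liftJ₂ (leviCivita g))
        (liftJ₃ (leviCivita g) J) (completeLift (leviCivita g) g) ↔
      IsFlat (leviCivita g) ∧ IsParallel (leviCivita g) J := by
  have hvanish := structureTensorVanishes_iff_isParallel
    (isPseudoRiemannian_completeLift hJg.metric)
  have h₁ := isParallel_liftJ₁_iff hJg.metric hJg.almostComplex
  have h₂ := isParallel_liftJ₂_iff hJg.metric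
  have h₃ := isParallel_liftJ₃_iff hJg.metric hJg.almostComplex
  exact ⟨fun h ↦ h₁.1 ((hvanish _).1 h.vanishes₁), fun h ↦
    ⟨isAlmostHypercomplexHermitianNorden_lift hJg, (hvanish _).2 (h₁.2 h), (hvanish _).2 (h₂.2 h.1),
      (hvanish _).2 (h₃.2 h)⟩⟩

end TangentBundle

end NordenTangent

end

theorem mainTheorem9 {E : Type*} [NormedAddCommGroup E] [NormedSpace ℝ E] [FiniteDimensional ℝ E]
    {M : Type*} [TopologicalSpace M] [ChartedSpace E M] [IsManifold 𝓘(ℝ, E) ∞ M]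
    (J : NordenTangent.EndField 𝓘(ℝ, E) M) (g : NordenTangent.FormField 𝓘(ℝ, E) M)
    (hJg : NordenTangent.IsAlmostNorden J g) :
    let D : NordenTangent.Connection 𝓘(ℝ, E) M := NordenTangent.leviCivita g
    let J₁ := NordenTangent.liftJ₁ D J
    let J₂ := NordenTangent.liftJ₂ D
    let J₃ := NordenTangent.liftJ₃ D J
    let gHat := NordenTangent.completeLift D g
    let DHat : NordenTangent.Connection 𝓘(ℝ, E).tangent (TangentBundle 𝓘(ℝ, E) M) :=
      NordenTangent.leviCivita gHat
    -- (i)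
    ((NordenTangent.IsParallel DHat J₁ ↔
        NordenTangent.IsFlat D ∧ NordenTangent.IsParallel D J) ∧
      (NordenTangent.IsComplex J₁ ∧ NordenTangent.IsParallel DHat J₁ ↔
        NordenTangent.IsFlat D ∧ NordenTangent.IsParallel D J) ∧
      (NordenTangent.IsParallel DHat J₃ ↔
        NordenTangent.IsFlat D ∧ NordenTangent.IsParallel D J) ∧
      (NordenTangent.IsComplex J₃ ∧ NordenTangent.IsParallel DHat J₃ ↔
        NordenTangent.IsFlat D ∧ NordenTangent.IsParallel D J)) ∧
    -- (ii)
    ((NordenTangent.IsParallel DHat J₂ ↔ NordenTangent.IsFlat D) ∧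
      (NordenTangent.IsComplex J₂ ∧ NordenTangent.IsParallel DHat J₂ ↔
        NordenTangent.IsFlat D)) ∧
    -- (iii)
    (NordenTangent.IsPseudoHyperKahler J₁ J₂ J₃ gHat ↔
      NordenTangent.IsFlat D ∧ NordenTangent.IsParallel D J) := by
  intro D J₁ J₂ J₃ gHat DHat
  have hg := hJg.metric
  have hJ := hJg.almostComplex
  have hgHat := NordenTangent.isPseudoRiemannian_completeLift hg
  have h₁ := NordenTangent.isParallel_liftJ₁_iff hg hJ
  have h₂ := NordenTangent.isParallel_liftJ₂_iff hg
  have h₃ := NordenTangent.isParallel_liftJ₃_iff hg hJ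
  have hcomplex₁ : NordenTangent.IsParallel DHat J₁ → NordenTangent.IsComplex J₁ :=
    NordenTangent.isComplex_of_isParallel hgHat (NordenTangent.isAlmostComplex_liftJ₁ hg hJ)
  have hcomplex₂ : NordenTangent.IsParallel DHat J₂ → NordenTangent.IsComplex J₂ :=
    NordenTangent.isComplex_of_isParallel hgHat (NordenTangent.isAlmostComplex_liftJ₂ hg)
  have hcomplex₃ : NordenTangent.IsParallel DHat J₃ → NordenTangent.IsComplex J₃ :=
    NordenTangent.isComplex_of_isParallel hgHat (NordenTangent.isAlmostComplex_liftJ₃ hg hJ)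
  exact ⟨⟨h₁, (and_iff_right_of_imp hcomplex₁).trans h₁, h₃,
      (and_iff_right_of_imp hcomplex₃).trans h₃⟩,
    ⟨h₂, (and_iff_right_of_imp hcomplex₂).trans h₂⟩, NordenTangent.isPseudoHyperKahler_lift_iff hJg⟩
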